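/- For coprime integers $a,b$ let $\alpha_{a,b}\colon \mathrm{U}(1)\to\mathrm{SU}(3)$, $\alpha_{a,b}(z)=\mathrm{diag}(z^{a},z^{b},z^{-a-b})$, and let the Aloff--Wallach space $W_{a,b}=\mathrm{SU}(3)/\alpha_{a,b}(\mathrm{U}(1))$ carry its left $\mathrm{SU}(3)$-action and the smooth structure for which the projection $\mathrm{SU}(3)\to W_{a,b}$ is a submersion. For $X\in\{D^4,S^3\}$, the closed unit ball and the unit sphere in $\mathbb{C}^2$, let $X\times_{\alpha_{a,b}}\mathrm{SU}(3)$ be the quotient of $X\times\mathrm{SU}(3)$ by the $\mathrm{U}(1)$-action $z\cdot(x,g)=(zx,g\,\alpha_{a,b}(z)^{-1})$, with $\mathrm{SU}(3)$ acting by left translation on the second factor. The space $D^4\times_{\alpha_{a,b}}\mathrm{SU}(3)$ is a $D^4$-bundle over $W_{a,b}$, and its boundary $S^3\times_{\alpha_{a,b}}\mathrm{SU}(3)$ is a principal $\mathrm{SU}(3)$-bundle over $S^3/\mathrm{U}(1)=\mathbb{C}\mathrm{P}^1=S^2$. **Theorem.** Let $p_1,p_2$ be coprime integers and let $q_1,q_2$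 be coprime integers. Then there is a compact connected smooth $11$-dimensional manifold $M$ (without boundary) with a smooth action of $\mathrm{SU}(3)$ such that: 1. the action has cohomogeneity three, i.e. the minimal codimension of an orbit is $3$; 2. there are exactly two singular orbits (orbits of less than maximal dimension) $O_1\neq O_2$, and all other orbits are principal (their isotropy groups are, up to conjugacy, contained in every isotropy group of the action); 3. $O_1$ and $O_2$ are embedded submanifolds which are $\mathrm{SU}(3)$-equivariantly diffeomorphic to $W_{p_1,p_2}$ and $W_{q_1,q_2}$, respectively; 4. $M$ is obtained by gluing the disc bundles $D^4\times_{\alpha_{p_1,p_2}}\mathrm{SU}(3)$ and $D^4\times_{\alpha_{q_1,q_2}}\mathrm{SU}(3)$ along an isomorphism $S^3\times_{\alpha_{p_1,p_2}}\mathrm{SU}(3)\to S^3\times_{\alpha_{q_1,q_2}}\mathrm{SU}(3)$ of $\mathrm{SU}(3)$-bundles over $S^2$ (covering the identity), and $O_1$, $O_2$ are the zero sections of these two disc bundles. -/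

import Mathlib

open scoped Manifold ContDiff Matrix Topology

/-- The group `SU(3)`, with the subspace topology. -/
abbrev SU3 : Type := Matrix.specialUnitaryGroup (Fin 3) ℂ

namespace SU3

noncomputable section

theorem star_val_mul (g : SU3) : (g : Matrix (Fin 3) (Fin 3) ℂ)ᴴ * g.1 = 1 :=
  Matrix.mem_unitaryGroup_iff'.1 (Matrix.mem_specialUnitaryGroup_iff.1 g.2).1

theorem val_inv (g : SU3) : (g⁻¹ : SU3).1 = g.1ᴴ := rfl

theorem det_val (g : SU3) : g.1.det = 1 :=
  (Matrix.mem_specialUnitaryGroup_iff.1 g.2).2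

instance : IsTopologicalGroup SU3 where
  continuous_mul := continuous_mul
  continuous_inv := by
    refine Continuous.subtype_mk (f := fun g : SU3 => g.1ᴴ) ?_ _
    exact continuous_subtype_val.matrix_conjTranspose

/-- Coordinates on `ℝ⁸`: the traceless skew-Hermitian matrix with the given coordinates. -/
def ofCoord : EuclideanSpace ℝ (Fin 8) →ₗ[ℝ] Matrix (Fin 3) (Fin 3) ℂ where
  toFun v := !![⟨0, v 0⟩, ⟨v 2, v 3⟩, ⟨v 4, v 5⟩;
    ⟨-v 2, v 3⟩, ⟨0, v 1⟩, ⟨v 6, v 7⟩;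
    ⟨-v 4, v 5⟩, ⟨-v 6, v 7⟩, ⟨0, -v 0 - v 1⟩]
  map_add' v w := by
    ext i j
    fin_cases i <;> fin_cases j <;> apply Complex.ext <;> simp <;> ring
  map_smul' c v := by
    ext i j
    fin_cases i <;> fin_cases j <;> apply Complex.ext <;> simp <;> ring

/-- The coordinates in `ℝ⁸` of the traceless skew-Hermitian part of a matrix. -/
def coord : Matrix (Fin 3) (Fin 3) ℂ →ₗ[ℝ] EuclideanSpace ℝ (Fin 8) where
  toFun X := !₂[(X 0 0).im - X.trace.im / 3, (X 1 1).im - X.trace.im / 3,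
    ((X 0 1).re - (X 1 0).re) / 2, ((X 0 1).im + (X 1 0).im) / 2,
    ((X 0 2).re - (X 2 0).re) / 2, ((X 0 2).im + (X 2 0).im) / 2,
    ((X 1 2).re - (X 2 1).re) / 2, ((X 1 2).im + (X 2 1).im) / 2]
  map_add' X Y := by
    ext i
    fin_cases i <;> simp [Matrix.trace_fin_three] <;> ring
  map_smul' c X := by
    ext i
    fin_cases i <;> simp [Matrix.trace_fin_three] <;> ring

theorem coord_ofCoord (v : EuclideanSpace ℝ (Fin 8)) : coord (ofCoord v) = v := by
  ext i
  fin_cases i <;> simp [coord, ofCoord, Matrix.trace_fin_three]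

/-- A smooth self-map of the `3 × 3` matrices whose derivative at `1` is the identity and
which straightens `SU(3)` near `1` to the space of traceless skew-Hermitian matrices. -/
def straighten (X : Matrix (Fin 3) (Fin 3) ℂ) : Matrix (Fin 3) (Fin 3) ℂ :=
  ofCoord (coord X) + (1 / 2 : ℝ) • (Xᴴ * X - 1) +
    (X.det.im / 3 : ℝ) • (Complex.I • (1 : Matrix (Fin 3) (Fin 3) ℂ))

theorem coord_straighten (X : Matrix (Fin 3) (Fin 3) ℂ) : coord (straighten X) = coord X := by
  have h1 : coord (Xᴴ * X - 1) = 0 := by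
    ext i
    fin_cases i <;>
      simp [coord, Matrix.trace_fin_three, Matrix.mul_apply, Fin.sum_univ_three] <;> ring
  have h2 : coord (Complex.I • (1 : Matrix (Fin 3) (Fin 3) ℂ)) = 0 := by
    ext i
    fin_cases i <;> simp [coord, Matrix.trace_fin_three] <;> norm_num
  simp only [straighten, map_add, map_smul, h1, h2, coord_ofCoord, smul_zero, add_zero]

theorem straighten_val (g : SU3) : straighten g.1 = ofCoord (coord g.1) := by
  simp [straighten, star_val_mul, det_val]

theorem mem_of_straighten {X : Matrix (Fin 3) (Fin 3) ℂ} (hX : 0 < X.det.re)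
    {v : EuclideanSpace ℝ (Fin 8)} (h : straighten X = ofCoord v) :
    X ∈ Matrix.specialUnitaryGroup (Fin 3) ℂ := by
  have hv : coord X = v := by rw [← coord_straighten, h, coord_ofCoord]
  have h0 : (1 / 2 : ℝ) • (Xᴴ * X - 1) +
      (X.det.im / 3 : ℝ) • (Complex.I • (1 : Matrix (Fin 3) (Fin 3) ℂ)) = 0 := by
    have := h
    rw [straighten, hv, add_assoc] at this
    simpa using this
  have h1 : Xᴴ * X = 1 := by
    have hc := congrArg Matrix.conjTranspose h0
    have e : (Complex.I • (1 : Matrix (Fin 3) (Fin 3) ℂ))ᴴ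
        = -(Complex.I • (1 : Matrix (Fin 3) (Fin 3) ℂ)) := by simp
    have hh : (Xᴴ * X - 1)ᴴ = Xᴴ * X - 1 := by
      simp [Matrix.conjTranspose_sub, Matrix.conjTranspose_mul]
    rw [Matrix.conjTranspose_add, Matrix.conjTranspose_smul, Matrix.conjTranspose_smul, e, hh] at hc
    simp only [star_trivial, Matrix.conjTranspose_zero] at hc
    have hs : Xᴴ * X - 1 = 0 := by
      calc Xᴴ * X - 1 = ((1 / 2 : ℝ) • (Xᴴ * X - 1) +
            (X.det.im / 3 : ℝ) • (Complex.I • (1 : Matrix (Fin 3) (Fin 3) ℂ))) +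
            ((1 / 2 : ℝ) • (Xᴴ * X - 1) +
            (X.det.im / 3 : ℝ) • -(Complex.I • (1 : Matrix (Fin 3) (Fin 3) ℂ))) := by module
        _ = 0 := by rw [h0, hc, add_zero]
    exact sub_eq_zero.1 hs
  have h2 : X.det.im = 0 := by
    rw [h1, sub_self, smul_zero, zero_add] at h0
    have := congrArg Complex.im (congrFun (congrFun h0 0) 0)
    simpa using this
  have h3 : star X.det * X.det = 1 := by
    have := congrArg Matrix.det h1
    rwa [Matrix.det_mul, Matrix.det_conjTranspose, Matrix.det_one] at this
  refine Matrix.mem_specialUnitaryGroup_iff.2 ⟨Matrix.mem_unitaryGroup_iff'.2 h1, ?_⟩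
  have h4 := congrArg Complex.re h3
  simp [h2] at h4
  apply Complex.ext
  · simp; nlinarith
  · simpa using h2

/-- The space of `3 × 3` matrices as a normed space (with the supremum norm). -/
abbrev Amb : Type := Fin 3 → Fin 3 → ℂ

/-- The inclusion of `SU(3)` into the space of matrices. -/
def val (g : SU3) : Amb := fun i j => g.1 i j

theorem of_val (g : SU3) : Matrix.of (val g) = g.1 := rfl

theorem isInducing_val : Topology.IsInducing val := Topology.IsInducing.subtypeVal

theorem continuous_val : Continuous val := isInducing_val.continuous

/-- `straighten` on the normed space of matrices. -/
def str (X : Amb) : Amb := fun i j => straighten (Matrix.of X) i j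

def coordA : Amb →L[ℝ] EuclideanSpace ℝ (Fin 8) :=
  LinearMap.toContinuousLinearMap
    { toFun := fun X => coord (Matrix.of X)
      map_add' := fun X Y => coord.map_add (Matrix.of X) (Matrix.of Y)
      map_smul' := fun c X => coord.map_smul c (Matrix.of X) }

def ofCoordA : EuclideanSpace ℝ (Fin 8) →L[ℝ] Amb :=
  LinearMap.toContinuousLinearMap
    { toFun := fun v i j => ofCoord v i j
      map_add' := fun v w => ofCoord.map_add v w
      map_smul' := fun c v => ofCoord.map_smul c v }

def mulA (X : Matrix (Fin 3) (Fin 3) ℂ) : Amb →L[ℝ] Amb :=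
  LinearMap.toContinuousLinearMap
    { toFun := fun Y i j => (X * Matrix.of Y) i j
      map_add' := fun Y Z => mul_add X (Matrix.of Y) (Matrix.of Z)
      map_smul' := fun c Y => mul_smul_comm c X (Matrix.of Y) }

theorem contDiff_entry (i j : Fin 3) : ContDiff ℝ ∞ (fun X : Amb => X i j) := by
  fun_prop

theorem contDiff_det : ContDiff ℝ ∞ (fun X : Amb => (Matrix.of X).det) := by
  simp only [Matrix.det_fin_three, Matrix.of_apply]
  fun_prop

theorem contDiff_str : ContDiff ℝ ∞ str := by
  have h1 : ContDiff ℝ ∞ (fun X => ofCoordA (coordA X)) := (ofCoordA.comp coordA).contDiff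
  refine contDiff_pi.2 fun i => contDiff_pi.2 fun j => ?_
  have h1' : ContDiff ℝ ∞ (fun X : Amb => ofCoord (coord (Matrix.of X)) i j) :=
    contDiff_pi.1 (contDiff_pi.1 h1 i) j
  have h2 : ContDiff ℝ ∞ (fun X : Amb => ((Matrix.of X)ᴴ * Matrix.of X - 1) i j) := by
    simp only [Matrix.sub_apply, Matrix.mul_apply, Matrix.conjTranspose_apply, Matrix.of_apply]
    refine ContDiff.sub (ContDiff.sum fun k _ => ContDiff.mul ?_ (contDiff_entry k j))
      contDiff_const
    exact Complex.conjCLE.contDiff.comp (contDiff_entry k i)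
  have h3 : ContDiff ℝ ∞ (fun X : Amb => (Matrix.of X).det.im / 3) :=
    (Complex.imCLM.contDiff.comp contDiff_det).div_const 3
  exact (h1'.add (h2.const_smul (1 / 2 : ℝ))).add (h3.smul contDiff_const)

theorem ofCoord_coord_add (v : Matrix (Fin 3) (Fin 3) ℂ) :
    ofCoord (coord v) + (1 / 2 : ℝ) • (vᴴ + v) +
      (v.trace.im / 3 : ℝ) • (Complex.I • (1 : Matrix (Fin 3) (Fin 3) ℂ)) = v := by
  ext i j
  fin_cases i <;> fin_cases j <;> apply Complex.ext <;>
    simp [coord, ofCoord, Matrix.trace_fin_three] <;> ring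

theorem hasDerivAt_det (v : Matrix (Fin 3) (Fin 3) ℂ) :
    HasDerivAt (fun t : ℝ => (1 + t • v).det) v.trace 0 := by
  have h : (fun t : ℝ => (1 + t • v).det) = fun t : ℝ => 1 + v.trace * (t : ℂ) +
      Polynomial.eval (t : ℂ) (Matrix.det
        (1 + (Polynomial.X : Polynomial ℂ) • v.map Polynomial.C)).divX.divX * (t : ℂ) ^ 2 := by
    funext t
    rw [← Matrix.det_one_add_smul]
    rfl
  rw [h]
  have hd : HasDerivAt (fun z : ℂ => 1 + v.trace * z +
      Polynomial.eval z (Matrix.det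
        (1 + (Polynomial.X : Polynomial ℂ) • v.map Polynomial.C)).divX.divX * z ^ 2)
      v.trace ((0 : ℝ) : ℂ) := by
    have h1 := ((hasDerivAt_id ((0 : ℝ) : ℂ)).const_mul v.trace).const_add 1
    have h2 := ((Matrix.det
        (1 + (Polynomial.X : Polynomial ℂ) • v.map Polynomial.C)).divX.divX.hasDerivAt
          ((0 : ℝ) : ℂ)).mul ((hasDerivAt_id ((0 : ℝ) : ℂ)).pow 2)
    have h3 := h1.add h2
    exact h3.congr_deriv (by simp)
  exact hd.comp_ofReal

theorem straighten_line (v : Matrix (Fin 3) (Fin 3) ℂ) (t : ℝ) :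
    straighten (1 + t • v) = straighten 1 + t • v + t ^ 2 • ((1 / 2 : ℝ) • (vᴴ * v)) +
      (((1 + t • v).det.im - t * v.trace.im) / 3 : ℝ) •
        (Complex.I • (1 : Matrix (Fin 3) (Fin 3) ℂ)) := by
  have hv : straighten (1 + t • v) = straighten 1 + t • (ofCoord (coord v) +
      (1 / 2 : ℝ) • (vᴴ + v) + (v.trace.im / 3 : ℝ) •
        (Complex.I • (1 : Matrix (Fin 3) (Fin 3) ℂ))) + t ^ 2 • ((1 / 2 : ℝ) • (vᴴ * v)) +
      (((1 + t • v).det.im - t * v.trace.im) / 3 : ℝ) •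
        (Complex.I • (1 : Matrix (Fin 3) (Fin 3) ℂ)) := by
    simp only [straighten, map_add, map_smul, Matrix.conjTranspose_add, Matrix.conjTranspose_one,
      Matrix.conjTranspose_smul, star_trivial, add_mul, mul_add, one_mul, mul_one, smul_mul_assoc,
      mul_smul_comm, Matrix.det_one, Complex.one_im]
    module
  rwa [ofCoord_coord_add] at hv

theorem hasFDerivAt_str :
    HasFDerivAt str ((ContinuousLinearEquiv.refl ℝ Amb : Amb ≃L[ℝ] Amb) : Amb →L[ℝ] Amb)
      (val 1) := by
  have hF := (contDiff_str.differentiable (by simp)).differentiableAt.hasFDerivAt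
    (x := val 1)
  have key : (ContinuousLinearEquiv.refl ℝ Amb : Amb →L[ℝ] Amb) = fderiv ℝ str (val 1) := by
    refine ContinuousLinearMap.ext fun v => ?_
    have hl : HasDerivAt (fun t : ℝ => val 1 + t • v) v 0 := by
      simpa using ((hasDerivAt_id (0 : ℝ)).smul_const v).const_add (val 1)
    have hA : HasDerivAt (fun t : ℝ => str (val 1 + t • v)) (fderiv ℝ str (val 1) v) 0 :=
      HasFDerivAt.comp_hasDerivAt (x := (0 : ℝ)) (l := str)
        (f := fun t : ℝ => val 1 + t • v) (by simpa using hF) hl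
    have hB : HasDerivAt (fun t : ℝ => str (val 1 + t • v)) v 0 := by
      refine hasDerivAt_pi.2 fun i => hasDerivAt_pi.2 fun j => ?_
      have e : (fun t : ℝ => str (val 1 + t • v) i j) = fun t : ℝ =>
          straighten 1 i j + t • v i j +
            t ^ 2 • ((1 / 2 : ℝ) • ((Matrix.of v)ᴴ * Matrix.of v) i j) +
            (((1 + t • Matrix.of v).det.im - t * (Matrix.of v).trace.im) / 3 : ℝ) •
              (Complex.I • (1 : Matrix (Fin 3) (Fin 3) ℂ)) i j := by
        funext t
        exact congrFun (congrFun (straighten_line (Matrix.of v) t) i) j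
      rw [e]
      have h1 := ((hasDerivAt_id (0 : ℝ)).smul_const (v i j)).const_add (straighten 1 i j)
      have h2 := (hasDerivAt_pow 2 (0 : ℝ)).smul_const
        ((1 / 2 : ℝ) • ((Matrix.of v)ᴴ * Matrix.of v) i j)
      have h3 := (((Complex.imCLM.hasFDerivAt.comp_hasDerivAt 0
        (hasDerivAt_det (Matrix.of v))).sub ((hasDerivAt_id (0 : ℝ)).mul_const
          (Matrix.of v).trace.im)).div_const 3).smul_const
            ((Complex.I • (1 : Matrix (Fin 3) (Fin 3) ℂ)) i j)
      exact ((h1.add h2).add h3).congr_deriv (by simp)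
    exact hB.unique hA
  rw [key]
  exact hF

/-- The restriction of `str` to a neighbourhood of `1` on which it is a diffeomorphism. -/
def strChart : OpenPartialHomeomorph Amb Amb :=
  ((contDiff_str.contDiffAt (x := val 1)).toOpenPartialHomeomorph str
    hasFDerivAt_str (by simp)).restr
    ({X | 0 < (Matrix.of X).det.re} ∩ fderiv ℝ str ⁻¹'
      Set.range ((↑) : (Amb ≃L[ℝ] Amb) → (Amb →L[ℝ] Amb)))

theorem strChart_coe : (strChart : Amb → Amb) = str := rfl

theorem isOpen_restr : IsOpen ({X : Amb | 0 < (Matrix.of X).det.re} ∩ fderiv ℝ str ⁻¹'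
      Set.range ((↑) : (Amb ≃L[ℝ] Amb) → (Amb →L[ℝ] Amb))) :=
  (isOpen_lt continuous_const (Complex.continuous_re.comp contDiff_det.continuous)).inter
    (ContinuousLinearEquiv.isOpen.preimage (contDiff_str.continuous_fderiv (by simp)))

theorem mem_strChart_source {X : Amb} (hX : X ∈ strChart.source) :
    0 < (Matrix.of X).det.re ∧ ∃ L : Amb ≃L[ℝ] Amb, (L : Amb →L[ℝ] Amb) = fderiv ℝ str X := by
  rw [strChart, OpenPartialHomeomorph.restr_source, isOpen_restr.interior_eq] at hX
  exact hX.2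

theorem val_one_mem_source : val 1 ∈ strChart.source := by
  rw [strChart, OpenPartialHomeomorph.restr_source, isOpen_restr.interior_eq]
  refine ⟨ContDiffAt.mem_toOpenPartialHomeomorph_source _ _ _, ?_, ?_⟩
  · change 0 < (Matrix.of (val 1)).det.re
    rw [of_val, det_val]
    simp
  · exact ⟨ContinuousLinearEquiv.refl ℝ _, hasFDerivAt_str.fderiv.symm⟩

theorem contDiffOn_symm : ContDiffOn ℝ ∞ strChart.symm strChart.target := by
  intro A hA
  obtain ⟨-, L, hL⟩ := mem_strChart_source (strChart.map_target hA)
  refine (strChart.contDiffAt_symm hA (f₀' := L) ?_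
    contDiff_str.contDiffAt).contDiffWithinAt
  rw [hL]
  exact (contDiff_str.differentiable (by simp)).differentiableAt.hasFDerivAt

theorem str_val (g : SU3) : str (val g) = ofCoordA (coordA (val g)) :=
  straighten_val g

theorem symm_mem {v : EuclideanSpace ℝ (Fin 8)} (hv : ofCoordA v ∈ strChart.target) :
    Matrix.of (strChart.symm (ofCoordA v)) ∈ Matrix.specialUnitaryGroup (Fin 3) ℂ :=
  mem_of_straighten (mem_strChart_source (strChart.map_target hv)).1
    (v := v) (strChart.right_inv hv)

open Classical in
/-- The inverse of the chart of `SU(3)` at `1`. -/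
def chartOneInv (v : EuclideanSpace ℝ (Fin 8)) : SU3 :=
  if hv : ofCoordA v ∈ strChart.target then
    ⟨Matrix.of (strChart.symm (ofCoordA v)), symm_mem hv⟩ else 1

theorem val_chartOneInv {v : EuclideanSpace ℝ (Fin 8)} (hv : ofCoordA v ∈ strChart.target) :
    val (chartOneInv v) = strChart.symm (ofCoordA v) := by
  rw [chartOneInv, dif_pos hv]
  rfl

theorem val_injective : Function.Injective val := fun _ _ h => Subtype.ext h

/-- The chart of `SU(3)` at `1`: the coordinates of the traceless skew-Hermitian part. -/
def chartOne : OpenPartialHomeomorph SU3 (EuclideanSpace ℝ (Fin 8)) where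
  toFun g := coordA (val g)
  invFun := chartOneInv
  source := val ⁻¹' strChart.source
  target := ofCoordA ⁻¹' strChart.target
  map_source' g hg := by
    have := strChart.map_source hg
    rwa [strChart_coe, str_val] at this
  map_target' v hv := by
    rw [Set.mem_preimage, val_chartOneInv hv]
    exact strChart.map_target hv
  left_inv' g hg := by
    have h1 := strChart.map_source hg
    have h2 := strChart.left_inv hg
    rw [strChart_coe, str_val] at h1 h2
    exact val_injective ((val_chartOneInv h1).trans h2)
  right_inv' v hv := by
    have h : str (strChart.symm (ofCoordA v)) = ofCoordA v := strChart.right_inv hv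
    rw [val_chartOneInv hv]
    calc coordA (strChart.symm (ofCoordA v)) = coordA (str (strChart.symm (ofCoordA v))) :=
          (coord_straighten _).symm
      _ = v := by rw [h]; exact coord_ofCoord v
  open_source := strChart.open_source.preimage continuous_val
  open_target := strChart.open_target.preimage ofCoordA.continuous
  continuousOn_toFun := (coordA.continuous.comp continuous_val).continuousOn
  continuousOn_invFun := by
    rw [isInducing_val.continuousOn_iff]
    have : ContinuousOn (fun v => strChart.symm (ofCoordA v)) (ofCoordA ⁻¹' strChart.target) :=
      strChart.continuousOn_symm.comp ofCoordA.continuous.continuousOn fun _ h => h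
    exact this.congr fun v hv => val_chartOneInv hv

/-- The translate to `g` of the chart at `1`. -/
def chart (g : SU3) : OpenPartialHomeomorph SU3 (EuclideanSpace ℝ (Fin 8)) :=
  (Homeomorph.mulLeft g⁻¹).toOpenPartialHomeomorph ≫ₕ chartOne

/-- The smooth structure of `SU(3)` as a submanifold of the space of matrices. -/
instance : ChartedSpace (EuclideanSpace ℝ (Fin 8)) SU3 where
  atlas := Set.range chart
  chartAt := chart
  mem_chart_source g := by
    simp only [chart, OpenPartialHomeomorph.trans_source,
      Homeomorph.toOpenPartialHomeomorph_source, Homeomorph.toOpenPartialHomeomorph_apply,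
      Set.univ_inter, Set.mem_preimage, Homeomorph.coe_mulLeft, inv_mul_cancel]
    exact val_one_mem_source
  chart_mem_atlas g := ⟨g, rfl⟩

theorem chart_apply (g h : SU3) : chart g h = coordA (mulA g.1ᴴ (val h)) := rfl

theorem chart_target (g : SU3) : (chart g).target = ofCoordA ⁻¹' strChart.target := by
  simp [chart, chartOne]

theorem val_chart_symm (g : SU3) {v : EuclideanSpace ℝ (Fin 8)} (hv : v ∈ (chart g).target) :
    val ((chart g).symm v) = mulA g.1 (strChart.symm (ofCoordA v)) := by
  rw [chart_target] at hv
  rw [← val_chartOneInv hv]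
  have : (chart g).symm v = g * chartOneInv v := by
    change (g⁻¹)⁻¹ * chartOneInv v = _
    rw [inv_inv]
  rw [this]
  rfl

theorem contDiffOn_chart_symm (g : SU3) :
    ContDiffOn ℝ ∞ (fun v => val ((chart g).symm v)) (chart g).target := by
  have h : ContDiffOn ℝ ∞ (fun v => mulA g.1 (strChart.symm (ofCoordA v)))
      (chart g).target := by
    refine (mulA g.1).contDiff.comp_contDiffOn (contDiffOn_symm.comp
      ofCoordA.contDiff.contDiffOn fun v hv => ?_)
    rwa [chart_target] at hv
  exact h.congr fun v hv => val_chart_symm g hv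

theorem contDiff_coord_mul (X : Matrix (Fin 3) (Fin 3) ℂ) :
    ContDiff ℝ ∞ (fun Y => coordA (mulA X Y)) :=
  coordA.contDiff.comp (mulA X).contDiff

instance : IsManifold (𝓡 8) ∞ SU3 := by
  refine isManifold_of_contDiffOn _ _ _ ?_
  rintro _ _ ⟨g, rfl⟩ ⟨h, rfl⟩
  have := (contDiff_coord_mul h.1ᴴ).comp_contDiffOn (contDiffOn_chart_symm g)
  simp only [mfld_simps]
  refine this.mono fun v hv => ?_
  simp only [mfld_simps] at hv
  exact hv.1

/-- The inclusion of `SU(3)` into the `3 × 3` matrices is smooth. -/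
theorem contMDiff_val : ContMDiff (𝓡 8) 𝓘(ℝ, Amb) ∞ val := by
  intro g
  rw [contMDiffAt_iff]
  refine ⟨continuous_val.continuousAt, ?_⟩
  have h := (contDiffOn_chart_symm g).contDiffAt
    ((chart g).open_target.mem_nhds ((chart g).map_source (mem_chart_source _ g)))
  exact h.contDiffWithinAt

/-- A map into `SU(3)` is smooth if it is smooth as a map into the `3 × 3` matrices. -/
theorem contMDiff_of_val {E H N : Type*} [NormedAddCommGroup E] [NormedSpace ℝ E]
    [TopologicalSpace H] {I : ModelWithCorners ℝ E H} [TopologicalSpace N] [ChartedSpace H N]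
    {f : N → SU3} (hf : ContMDiff I 𝓘(ℝ, Amb) ∞ (fun x => val (f x))) :
    ContMDiff I (𝓡 8) ∞ f := by
  intro x
  rw [contMDiffAt_iff_target]
  refine ⟨(isInducing_val.continuous_iff.2 hf.continuous).continuousAt, ?_⟩
  exact ((contDiff_coord_mul (f x).1ᴴ).contMDiff.comp hf) x

instance : LieGroup (𝓡 8) ∞ SU3 where
  contMDiff_mul := by
    refine contMDiff_of_val ?_
    have h1 : ContMDiff ((𝓡 8).prod (𝓡 8)) 𝓘(ℝ, Amb) ∞ (fun p : SU3 × SU3 => val p.1) :=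
      contMDiff_val.comp contMDiff_fst
    have h2 : ContMDiff ((𝓡 8).prod (𝓡 8)) 𝓘(ℝ, Amb) ∞ (fun p : SU3 × SU3 => val p.2) :=
      contMDiff_val.comp contMDiff_snd
    have hm : ContDiff ℝ ∞ (fun p : Amb × Amb => fun i j => ∑ k, p.1 i k * p.2 k j) := by
      fun_prop
    exact hm.contMDiff.comp (h1.prodMk_space h2)
  contMDiff_inv := by
    refine contMDiff_of_val ?_
    have hm : ContDiff ℝ ∞ (fun X : Amb => fun i j => Complex.conjCLE (X j i)) := by
      fun_prop
    exact hm.contMDiff.comp contMDiff_val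

end

end SU3

/-- The homomorphism `U(1) → SU(3)`, `z ↦ diag(z^p, z^q, z^(-p-q))`. -/
noncomputable def torusHom (p q : ℤ) : Circle →* SU3 where
  toFun z := ⟨Matrix.diagonal ![((z ^ p : Circle) : ℂ), ((z ^ q : Circle) : ℂ),
    ((z ^ (-p - q) : Circle) : ℂ)], by
      rw [Matrix.mem_specialUnitaryGroup_iff]
      constructor
      · rw [Matrix.mem_unitaryGroup_iff, Matrix.star_eq_conjTranspose,
          Matrix.diagonal_conjTranspose, Matrix.diagonal_mul_diagonal, ← Matrix.diagonal_one]
        congr 1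
        funext i
        fin_cases i <;> simp [← Circle.coe_inv_eq_conj, -Circle.coe_zpow]
      · rw [Matrix.det_diagonal, Fin.prod_univ_three]
        change ((z ^ p : Circle) : ℂ) * ((z ^ q : Circle) : ℂ) * ((z ^ (-p - q) : Circle) : ℂ) = 1
        rw [← Circle.coe_mul, ← Circle.coe_mul, ← zpow_add, ← zpow_add]
        simp⟩
  map_one' := by
    apply Subtype.ext
    ext i j
    fin_cases i <;> fin_cases j <;> simp
  map_mul' z w := by
    apply Subtype.ext
    change Matrix.diagonal _ = Matrix.diagonal _ * Matrix.diagonal _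
    rw [Matrix.diagonal_mul_diagonal]
    congr 1
    funext i
    fin_cases i <;> simp [mul_zpow]

/-- The Aloff–Wallach space `W_{p,q}`, the space of left cosets of the image of `torusHom p q`,
with the quotient topology and the action of `SU(3)` by left translation. -/
abbrev AloffWallach (p q : ℤ) : Type := SU3 ⧸ (torusHom p q).range

section GManifold

variable {E H E' H' : Type*} [NormedAddCommGroup E] [NormedSpace ℝ E] [TopologicalSpace H]
  [NormedAddCommGroup E'] [NormedSpace ℝ E'] [TopologicalSpace H']
  (I : ModelWithCorners ℝ E H) (J : ModelWithCorners ℝ E' H')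
  (G : Type*) [TopologicalSpace G] [ChartedSpace H G] [Group G]
  {M : Type*} [TopologicalSpace M] [ChartedSpace H' M] [MulAction G M]

/-- The tangent space at `m` to the orbit of `m`, for a smooth action of a Lie group: the image
of the differential at `1` of the orbit map `g ↦ g • m`. -/
noncomputable def orbitTangent (m : M) : Submodule ℝ (TangentSpace J ((1 : G) • m)) :=
  LinearMap.range (mfderiv I J (fun g : G => g • m) 1).toLinearMap

/-- The dimension of the orbit of `m`. -/
noncomputable def orbitDim (m : M) : ℕ :=
  Module.finrank ℝ (orbitTangent I J G m)

/-- The codimension of the orbit of `m`. -/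
noncomputable def orbitCodim (m : M) : ℕ :=
  Module.finrank ℝ (TangentSpace J ((1 : G) • m) ⧸ orbitTangent I J G m)

variable (M) in
/-- The cohomogeneity of a smooth action is the smallest codimension of an orbit. -/
def HasCohomogeneity (k : ℕ) : Prop :=
  IsLeast (Set.range fun m : M => orbitCodim I J G m) k

/-- An orbit is principal if its isotropy groups are, up to conjugacy, contained in all
isotropy groups of the action. -/
def IsPrincipalOrbit (O : Set M) : Prop :=
  ∃ m : M, O = MulAction.orbit G m ∧
    ∀ m' : M, ∃ g : G, MulAction.stabilizer G (g • m) ≤ MulAction.stabilizer G m'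

/-- An orbit is singular if its dimension is not the maximal dimension of an orbit. -/
def IsSingularOrbit (O : Set M) : Prop :=
  ∃ m : M, O = MulAction.orbit G m ∧ ∃ m' : M, orbitDim I J G m < orbitDim I J G m'

end GManifold

section

variable {M : Type*} [TopologicalSpace M] [ChartedSpace (EuclideanSpace ℝ (Fin 11)) M]
  [MulAction SU3 M]

/-- The subset `O` of `M` is `SU(3)`-equivariantly diffeomorphic to `W_{p,q}`: for the smooth
structure on `W_{p,q}` that makes the projection from `SU(3)` a submersion, it is the image of an
equivariant smooth embedding of `W_{p,q}`. -/
def IsAloffWallachOrbit (p q : ℤ) (O : Set M) : Prop :=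
  ∃ _ : ChartedSpace (EuclideanSpace ℝ (Fin 7)) (AloffWallach p q),
    IsManifold (𝓡 7) ∞ (AloffWallach p q) ∧
    Manifold.IsSubmersion (𝓡 8) (𝓡 7) ∞ (QuotientGroup.mk : SU3 → AloffWallach p q) ∧
    ∃ f : AloffWallach p q → M, Manifold.IsSmoothEmbedding (𝓡 7) (𝓡 11) ∞ f ∧
      (∀ (g : SU3) (w : AloffWallach p q), f (g • w) = g • f w) ∧ Set.range f = O

end

/-- The Hermitian space `ℂ²`. -/
abbrev C2 : Type := EuclideanSpace ℂ (Fin 2)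

/-- The orbit relation of the action `z · (x, g) = (z x, g α(z)⁻¹)` of `U(1)` on
`ℂ² × SU(3)`; the action is free if `α` is injective. -/
def assocSetoid (α : Circle →* SU3) : Setoid (C2 × SU3) where
  r a b := ∃ z : Circle, b = ((z : ℂ) • a.1, a.2 * (α z)⁻¹)
  iseqv := by
    refine ⟨fun a => ⟨1, by simp⟩, ?_, ?_⟩
    · rintro a _ ⟨z, rfl⟩
      exact ⟨z⁻¹, by simp [smul_smul]⟩
    · rintro a _ _ ⟨z, rfl⟩ ⟨w, rfl⟩
      exact ⟨w * z, by simp [smul_smul, mul_assoc]⟩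

/-- The space `ℂ² ×_α SU(3)`; for injective `α` it is a `ℂ²`-bundle over `SU(3) / α(U(1))`. -/
def AssocBundle (α : Circle →* SU3) : Type := Quotient (assocSetoid α)

namespace AssocBundle

variable (α β : Circle →* SU3)

/-- The projection `ℂ² × SU(3) → ℂ² ×_α SU(3)`. -/
def mk (a : C2 × SU3) : AssocBundle α := Quotient.mk (assocSetoid α) a

instance : TopologicalSpace (AssocBundle α) :=
  inferInstanceAs (TopologicalSpace (Quotient (assocSetoid α)))

/-- `SU(3)` acts by left translation on the second factor. -/
instance : MulAction SU3 (AssocBundle α) where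
  smul g := Quotient.map (fun a => (a.1, g * a.2)) (by
    rintro a _ ⟨z, rfl⟩
    exact ⟨z, by simp [mul_assoc]⟩)
  one_smul := by
    rintro ⟨a⟩
    exact congrArg (mk α) (by simp)
  mul_smul := by
    rintro g h ⟨a⟩
    exact congrArg (mk α) (by simp [mul_assoc])

theorem smul_mk (g : SU3) (a : C2 × SU3) : g • mk α a = mk α (a.1, g * a.2) := rfl

/-- The zero section, the orbit `SU(3) / α(U(1))`. -/
def zeroSection : Set (AssocBundle α) := mk α '' {a | a.1 = 0}

/-- The disc bundle `D⁴ ×_α SU(3)`. -/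
def disc : Set (AssocBundle α) := mk α '' {a | ‖a.1‖ ≤ 1}

/-- The sphere bundle `S³ ×_α SU(3)`, which is also a principal `SU(3)`-bundle over
`S³ / U(1) = ℂP¹ = S²`, with projection `[x, g] ↦ [x]`. -/
def sphere : Set (AssocBundle α) := mk α '' {a | ‖a.1‖ = 1}

/-- An isomorphism `S³ ×_α SU(3) → S³ ×_β SU(3)` of `SU(3)`-bundles over `ℂP¹`: an equivariant
homeomorphism that covers the identity of `ℂP¹`. -/
structure SphereIso where
  toHomeomorph : sphere α ≃ₜ sphere β
  map_smul : ∀ (g : SU3) (b b' : sphere α), (b' : AssocBundle α) = g • (b : AssocBundle α) →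
    (toHomeomorph b' : AssocBundle β) = g • (toHomeomorph b : AssocBundle β)
  covers_id : ∀ (b : sphere α) (x : C2) (g : SU3), (b : AssocBundle α) = mk α (x, g) →
    ∃ h : SU3, (toHomeomorph b : AssocBundle β) = mk β (x, h)

variable {M : Type*} [TopologicalSpace M] [ChartedSpace (EuclideanSpace ℝ (Fin 11)) M]
  [MulAction SU3 M]

variable {α} in
/-- `j` is an equivariant diffeomorphism of `ℂ² ×_α SU(3)` onto an open subset of `M`. For
injective `α`, `ℂ² ×_α SU(3)` is the quotient of `ℂ² × SU(3)` by a free action of `U(1)`, so this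
means that `j` is injective and that its lift to `ℂ² × SU(3)` is a submersion. -/
structure IsTube (j : AssocBundle α → M) : Prop where
  injective : Function.Injective j
  map_smul : ∀ (g : SU3) (b : AssocBundle α), j (g • b) = g • j b
  isSubmersion : Manifold.IsSubmersion (𝓘(ℝ, C2).prod (𝓡 8)) (𝓡 11) ∞ (j ∘ mk α)

/-- `M` is obtained by gluing the disc bundles `D⁴ ×_α SU(3)` and `D⁴ ×_β SU(3)` along an
isomorphism `S³ ×_α SU(3) → S³ ×_β SU(3)` of `SU(3)`-bundles over `ℂP¹`, and `O₁`, `O₂` are the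
zero sections of these bundles. -/
def IsGluing (O₁ O₂ : Set M) : Prop :=
  ∃ (j₁ : AssocBundle α → M) (j₂ : AssocBundle β → M) (φ : SphereIso α β),
    IsTube j₁ ∧ IsTube j₂ ∧ j₁ '' zeroSection α = O₁ ∧ j₂ '' zeroSection β = O₂ ∧
    j₁ '' disc α ∪ j₂ '' disc β = Set.univ ∧
    j₁ '' disc α ∩ j₂ '' disc β = j₁ '' sphere α ∧
    ∀ b : sphere α, j₁ b = j₂ (φ.toHomeomorph b)

end AssocBundle

/-! ### Topology of `SU(3)` -/

namespace SU3

/-! Off its zero section, the tube ℂ² ×_α SU(3) is a principal SU(3)-bundle over (ℂ² ∖ 0)/U(1) ≃ S²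
× (0, ∞). Such a bundle is trivial because SU(3) is simply connected. A trivialization amounts to a
map F : ℂ² ∖ 0 → SU(3) with F(zx) = α(z)F(x), since g F(x) then depends only on the class [x, g].
For the homomorphism with weights p, q, -p-q an explicit smooth F is `frame`, a product of two
SU(2)-blocks built from normalized powers of the coordinates.

Given F₁ and F₂, the two tubes are glued off their zero sections by inverting x in the unit sphere
and matching the trivializations: [x, g] is identified with [y, h], where y = x/|x|² and h F₂(y) = g
F₁(x) (`glue`). Inversion fixes the unit sphere, so the sphere bundles are identified over the
identity of ℂP¹, and the two closed disc bundles cover the result and meet only there. Compactness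
follows. For the Hausdorff property, the only pairs outside a common tube lie on different zero
sections, and the open disc bundles separate them.

Off the zero sections g F(x) is a global smooth equivariant map to SU(3) (`toSU3`). Hence isotropy
is trivial there and every orbit map has a smooth local left inverse, so these orbits are principal,
of dimension 8 and codimension 3. On a zero section the orbit map factors locally through ℝ⁷, so the
dimension drops.

The smooth structures of the coset spaces and of the glued space come from quotients by U(1).
`FlowAtlas` treats both at once: it needs saturated open sets that split as (open set) × U(1), and
smooth lifts of the identifications. The splittings come from a slice in SU(3)
(`torusHom.exists_slice`), and this is where coprimality enters. If mp + nq = 1, the product of the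
m-th power of g₀₀ and the n-th power of g₁₁ (conjugates replacing negative powers) is multiplied by
z when g is replaced by g α(z). Its direction is therefore a phase along whole U(1)-orbits, and the
inverse function theorem supplies the transverse coordinates. -/

theorem range_val : Set.range val =
    {X : Amb | (Matrix.of X)ᴴ * Matrix.of X = 1 ∧ (Matrix.of X).det = 1} := by
  ext X
  constructor
  · rintro ⟨g, rfl⟩
    exact ⟨star_val_mul g, det_val g⟩
  · rintro ⟨h1, h2⟩
    exact ⟨⟨Matrix.of X, Matrix.mem_specialUnitaryGroup_iff.2
      ⟨Matrix.mem_unitaryGroup_iff'.2 h1, h2⟩⟩, rfl⟩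

theorem isClosed_range_val : IsClosed (Set.range val) := by
  rw [range_val]
  have hof : Continuous fun X : Amb => (Matrix.of X : Matrix (Fin 3) (Fin 3) ℂ) := continuous_id
  exact (isClosed_eq (hof.matrix_conjTranspose.matrix_mul hof) continuous_const).inter
    (isClosed_eq hof.matrix_det continuous_const)

theorem norm_val_le (g : SU3) : ‖val g‖ ≤ 1 := by
  refine (pi_norm_le_iff_of_nonneg zero_le_one).2 fun i =>
    (pi_norm_le_iff_of_nonneg zero_le_one).2 fun j => ?_
  exact entry_norm_bound_of_unitary (Matrix.mem_specialUnitaryGroup_iff.1 g.2).1 i j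

theorem isClosedEmbedding_val : Topology.IsClosedEmbedding val :=
  ⟨⟨isInducing_val, val_injective⟩, isClosed_range_val⟩

instance : CompactSpace SU3 := by
  refine ⟨isClosedEmbedding_val.isInducing.isCompact_iff.2 ?_⟩
  rw [Set.image_univ]
  refine (isCompact_closedBall (0 : Amb) 1).of_isClosed_subset isClosed_range_val ?_
  rintro _ ⟨g, rfl⟩
  simpa using norm_val_le g

instance : T2Space SU3 := isClosedEmbedding_val.isEmbedding.t2Space

/-! ### Path connectedness of SU(3) -/

section Connected

open scoped Matrix.Norms.L2Operator

/-- The spectrum is finite and the circle is infinite. The resulting scalar is used to rotate a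
unitary matrix until `-1` is no longer an eigenvalue. -/
theorem exists_neg_notMem_spectrum (A : Matrix (Fin 3) (Fin 3) ℂ) :
    ∃ z : Circle, -(z : ℂ) ∉ spectrum ℂ A := by
  have hinj : Function.Injective fun z : Circle => -(z : ℂ) := fun a b h =>
    Circle.ext (neg_injective h)
  by_contra! h
  have : Infinite (Set.Ioo (0 : ℝ) 1) := (Set.Ioo_infinite zero_lt_one).to_subtype
  have : Infinite Circle := by
    refine Infinite.of_injective (fun t : Set.Ioo (0 : ℝ) 1 => Circle.exp t) ?_
    intro s t h
    have harg (r : Set.Ioo (0 : ℝ) 1) : Complex.arg (Circle.exp r) = r :=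
      Circle.arg_exp (by linarith [r.2.1, Real.pi_pos]) (by linarith [r.2.2, Real.pi_gt_three])
    exact Subtype.ext (by
      rw [← harg s, ← harg t]
      exact congrArg (fun z : Circle => Complex.arg z) h)
  exact Set.infinite_univ (α := Circle)
    ((A.finite_spectrum.preimage hinj.injOn).subset fun z _ => h z)

theorem smul_mem_unitary (w : Circle) (u : unitary (Matrix (Fin 3) (Fin 3) ℂ)) :
    (w : ℂ) • (u : Matrix (Fin 3) (Fin 3) ℂ) ∈ unitary (Matrix (Fin 3) (Fin 3) ℂ) := by
  have hw : (starRingEnd ℂ) (w : ℂ) * (w : ℂ) = 1 := by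
    rw [← Circle.coe_inv_eq_conj, ← Circle.coe_mul, inv_mul_cancel, Circle.coe_one]
  rw [Unitary.mem_iff]
  constructor
  · rw [star_smul, smul_mul_smul_comm, Unitary.coe_star_mul_self]
    simp [hw]
  · have hu : (u : Matrix (Fin 3) (Fin 3) ℂ) * star (u : Matrix (Fin 3) (Fin 3) ℂ) = 1 :=
      Unitary.coe_mul_star_self u
    rw [star_smul, smul_mul_smul_comm, hu, mul_comm]
    simp [hw]

/-- After multiplication by a suitable `z⁻¹` the matrix lacks the eigenvalue `-1`, so its distance
from `1` is less than 2 and it is joined to `1`. A path from `z⁻¹` to `1` in the circle then removes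
the scalar. -/
theorem joined_one_of_unitary (u : unitary (Matrix (Fin 3) (Fin 3) ℂ)) : Joined 1 u := by
  obtain ⟨z, hz⟩ := exists_neg_notMem_spectrum (u : Matrix (Fin 3) (Fin 3) ℂ)
  have h1 : Joined (1 : unitary (Matrix (Fin 3) (Fin 3) ℂ)) ⟨_, smul_mem_unitary z⁻¹ u⟩ := by
    refine Unitary.joined _ _ ?_
    refine (Unitary.norm_sub_one_lt_two_iff (smul_mem_unitary z⁻¹ u)).2 fun h => hz ?_
    have hz0 : IsUnit (z : ℂ) := isUnit_iff_ne_zero.2 z.coe_ne_zero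
    have := (spectrum.smul_mem_smul_iff (r := hz0.unit)).2 h
    rw [Units.smul_def, Units.smul_def, smul_smul, IsUnit.unit_spec, ← Circle.coe_mul] at this
    simpa using this
  refine h1.trans ?_
  have hc : Continuous fun w : Circle =>
      (⟨_, smul_mem_unitary w u⟩ : unitary (Matrix (Fin 3) (Fin 3) ℂ)) :=
    Continuous.subtype_mk (by fun_prop) _
  have := (PathConnectedSpace.joined z⁻¹ (1 : Circle)).map hc
  simpa using this

/-- A retraction of the unitary group onto `SU(3)`. -/
noncomputable def ofUnitary (u : Matrix.unitaryGroup (Fin 3) ℂ) : SU3 :=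
  ⟨u.1 * Matrix.diagonal ![star u.1.det, 1, 1], by
    have hd : u.1.det * star u.1.det = 1 := by
      have := congrArg Matrix.det (Matrix.mem_unitaryGroup_iff.1 u.2)
      rwa [Matrix.det_mul, Matrix.star_eq_conjTranspose, Matrix.det_conjTranspose,
        Matrix.det_one] at this
    refine Matrix.mem_specialUnitaryGroup_iff.2 ⟨mul_mem u.2 ?_, ?_⟩
    · rw [Matrix.mem_unitaryGroup_iff, Matrix.star_eq_conjTranspose,
        Matrix.diagonal_conjTranspose, Matrix.diagonal_mul_diagonal, ← Matrix.diagonal_one]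
      congr 1
      funext i
      rw [mul_comm] at hd
      fin_cases i
      · simpa using hd
      · simp
      · simp
    · simpa [Matrix.det_mul, Matrix.det_diagonal, Fin.prod_univ_three] using hd⟩

theorem continuous_ofUnitary : Continuous ofUnitary := by
  refine Continuous.subtype_mk (continuous_subtype_val.matrix_mul
    (Continuous.matrix_diagonal ?_)) _
  refine continuous_pi fun i => ?_
  have : Continuous fun u : Matrix.unitaryGroup (Fin 3) ℂ => star u.1.det :=
    continuous_subtype_val.matrix_det.star
  fin_cases i
  · exact this
  · exact continuous_const
  · exact continuous_const

theorem ofUnitary_surjective : Function.Surjective ofUnitary := by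
  intro g
  refine ⟨⟨g.1, (Matrix.mem_specialUnitaryGroup_iff.1 g.2).1⟩, Subtype.ext ?_⟩
  have : ![star g.1.det, 1, 1] = fun _ => 1 := by
    rw [det_val]
    funext i
    fin_cases i <;> simp
  change g.1 * Matrix.diagonal ![star g.1.det, 1, 1] = g.1
  rw [this, Matrix.diagonal_one, mul_one]

instance : PathConnectedSpace SU3 := by
  have : PathConnectedSpace (unitary (Matrix (Fin 3) (Fin 3) ℂ)) :=
    ⟨⟨1⟩, fun u v => (joined_one_of_unitary u).symm.trans (joined_one_of_unitary v)⟩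
  exact ofUnitary_surjective.pathConnectedSpace continuous_ofUnitary

end Connected

end SU3

/-! ### Smoothness of maps into SU(3) -/

namespace SU3

/-- A map into `SU(3)` is smooth on a set if it is smooth there as a map into the matrices. -/
theorem contMDiffOn_of_val {E H N : Type*} [NormedAddCommGroup E] [NormedSpace ℝ E]
    [TopologicalSpace H] {I : ModelWithCorners ℝ E H} [TopologicalSpace N] [ChartedSpace H N]
    {f : N → SU3} {s : Set N} (hf : ContMDiffOn I 𝓘(ℝ, Amb) ∞ (fun x => val (f x)) s) :
    ContMDiffOn I (𝓡 8) ∞ f s := by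
  intro x hx
  rw [contMDiffWithinAt_iff_target]
  refine ⟨isInducing_val.continuousWithinAt_iff.2 (hf x hx).continuousWithinAt, ?_⟩
  exact ((contDiff_coord_mul (f x).1ᴴ).contMDiff.comp_contMDiffOn hf) x hx

end SU3

/-! ### Smooth powers -/

/-- The smooth function on `ℂ` that agrees on the unit circle with `z ↦ z ^ n`, for an integer
`n`: it is `z ^ n` if `0 ≤ n` and `conj z ^ (-n)` otherwise. -/
noncomputable def smoothPow (n : ℤ) (z : ℂ) : ℂ :=
  if 0 ≤ n then z ^ n.toNat else (Complex.conjCLE z) ^ (-n).toNat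

namespace smoothPow

/-- Smoothness at `0` is the point: a coordinate of a nonzero vector of ℂ² may vanish, and there a
true negative power would break down. -/
theorem contDiff (n : ℤ) : ContDiff ℝ ∞ (smoothPow n) := by
  unfold smoothPow
  split_ifs
  · exact contDiff_id.pow _
  · exact Complex.conjCLE.contDiff.pow _

theorem map_mul (n : ℤ) (z w : ℂ) : smoothPow n (z * w) = smoothPow n z * smoothPow n w := by
  unfold smoothPow
  split_ifs
  · exact mul_pow _ _ _
  · rw [← mul_pow]
    simp

theorem coe_circle (n : ℤ) (z : Circle) : smoothPow n z = (z ^ n : Circle) := by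
  unfold smoothPow
  split_ifs with h
  · lift n to ℕ using h
    simp
  · obtain ⟨m, rfl⟩ : ∃ m : ℕ, n = -m := ⟨(-n).toNat, by omega⟩
    rw [zpow_neg, ← inv_zpow, Circle.coe_zpow, Circle.coe_inv_eq_conj]
    simp

theorem eq_zero {n : ℤ} {z : ℂ} (h : smoothPow n z = 0) : z = 0 := by
  unfold smoothPow at h
  split_ifs at h
  · exact eq_zero_of_pow_eq_zero h
  · simpa using eq_zero_of_pow_eq_zero h

end smoothPow

/-! ### Normalized pairs of complex numbers -/

/-- The first entry of the unit vector in the direction of `(a, b)`. -/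
noncomputable def unitFst (a b : ℂ) : ℂ :=
  a * ((√(Complex.normSq a + Complex.normSq b))⁻¹ : ℝ)

namespace unitFst

theorem normSq_pos {a b : ℂ} (h : a ≠ 0 ∨ b ≠ 0) :
    0 < Complex.normSq a + Complex.normSq b := by
  rcases h with h | h
  · exact add_pos_of_pos_of_nonneg (Complex.normSq_pos.2 h) (Complex.normSq_nonneg b)
  · exact add_pos_of_nonneg_of_pos (Complex.normSq_nonneg a) (Complex.normSq_pos.2 h)

theorem unit {a b : ℂ} (h : a ≠ 0 ∨ b ≠ 0) :
    unitFst a b * star (unitFst a b) + unitFst b a * star (unitFst b a) = 1 := by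
  have h0 := normSq_pos h
  have h1 : (√(Complex.normSq a + Complex.normSq b))⁻¹ * (√(Complex.normSq a + Complex.normSq b))⁻¹
      * (Complex.normSq a + Complex.normSq b) = 1 := by
    rw [← mul_inv, Real.mul_self_sqrt h0.le, inv_mul_cancel₀ h0.ne']
  have h2 := congrArg (fun r : ℝ => (r : ℂ)) h1
  simp only [Complex.ofReal_mul, Complex.ofReal_add, ← Complex.mul_conj, Complex.ofReal_one] at h2
  rw [unitFst, unitFst, add_comm (Complex.normSq b), star_mul', star_mul']
  simp only [Complex.star_def, Complex.conj_ofReal]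
  linear_combination h2

/-- The normalizing factor sees only absolute values, so the two entries may be rotated
independently. This is needed for pairs of different weights, such as `p + q` and `q`. -/
theorem mul_circle (z w : Circle) (a b : ℂ) : unitFst (z * a) (w * b) = z * unitFst a b := by
  simp [unitFst, mul_assoc]

theorem contDiff_normSq : ContDiff ℝ ∞ (fun z : ℂ => Complex.normSq z) := by
  simp only [Complex.normSq_apply]
  have h1 : ContDiff ℝ ∞ (fun z : ℂ => z.re) := Complex.reCLM.contDiff
  have h2 : ContDiff ℝ ∞ (fun z : ℂ => z.im) := Complex.imCLM.contDiff
  exact (h1.mul h1).add (h2.mul h2)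

theorem contDiffOn {E : Type*} [NormedAddCommGroup E] [NormedSpace ℝ E] {a b : E → ℂ} {s : Set E}
    (ha : ContDiffOn ℝ ∞ a s) (hb : ContDiffOn ℝ ∞ b s) (h : ∀ x ∈ s, a x ≠ 0 ∨ b x ≠ 0) :
    ContDiffOn ℝ ∞ (fun x => unitFst (a x) (b x)) s := by
  have h1 : ContDiffOn ℝ ∞ (fun x => Complex.normSq (a x) + Complex.normSq (b x)) s :=
    (contDiff_normSq.comp_contDiffOn ha).add (contDiff_normSq.comp_contDiffOn hb)
  have h2 : ContDiffOn ℝ ∞ (fun x => (√(Complex.normSq (a x) + Complex.normSq (b x)))⁻¹) s :=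
    (h1.sqrt fun x hx => (normSq_pos (h x hx)).ne').inv
      fun x hx => (Real.sqrt_pos.2 (normSq_pos (h x hx))).ne'
  exact ha.mul (Complex.ofRealCLM.contDiff.comp_contDiffOn h2)

end unitFst

/-! ### An equivariant map from the punctured plane to `SU(3)` -/

/-- An element of `SU(3)` built from two unit vectors of `ℂ²`. -/
noncomputable def frameMatrix (a b s t : ℂ) : Matrix (Fin 3) (Fin 3) ℂ :=
  !![a, b, 0; -(s * star b), s * star a, t; star b * star t, -(star a * star t), star s]

/-- The matrix is the product of the SU(2)-block with first row (s, t) in the last two coordinates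
and the SU(2)-block with first row (a, b) in the first two. -/
theorem frameMatrix_mem {a b s t : ℂ} (h : a * star a + b * star b = 1)
    (h' : s * star s + t * star t = 1) :
    frameMatrix a b s t ∈ Matrix.specialUnitaryGroup (Fin 3) ℂ := by
  refine Matrix.mem_specialUnitaryGroup_iff.2 ⟨Matrix.mem_unitaryGroup_iff.2 ?_, ?_⟩
  · rw [Matrix.star_eq_conjTranspose]
    simp only [Complex.star_def] at h h'
    ext i j
    fin_cases i <;> fin_cases j <;>
      simp [frameMatrix, Matrix.mul_apply, Fin.sum_univ_three]
    · linear_combination h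
    · ring
    · ring
    · ring
    · linear_combination s * (starRingEnd ℂ) s * h + h'
    · linear_combination (-s * t) * h
    · ring
    · linear_combination (-(starRingEnd ℂ) s * (starRingEnd ℂ) t) * h
    · linear_combination t * (starRingEnd ℂ) t * h + h'
  · rw [Matrix.det_fin_three]
    simp [frameMatrix]
    simp only [Complex.star_def] at h h'
    linear_combination (s * (starRingEnd ℂ) s + t * (starRingEnd ℂ) t) * h + h'

theorem c2_ne_zero {x : C2} (hx : x ≠ 0) : x 0 ≠ 0 ∨ x 1 ≠ 0 := by
  by_contra! h
  exact hx (by ext i; fin_cases i; exacts [h.1, h.2])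

theorem smoothPow_ne_zero {x : C2} (hx : x ≠ 0) (m n : ℤ) :
    smoothPow m (x 0) ≠ 0 ∨ smoothPow n (x 1) ≠ 0 :=
  (c2_ne_zero hx).imp (mt smoothPow.eq_zero) (mt smoothPow.eq_zero)

/-- The rows of this matrix are sections of weights `p`, `q` and `-p - q` over the punctured
plane. -/
noncomputable def frameFun (p q : ℤ) (x : C2) : Matrix (Fin 3) (Fin 3) ℂ :=
  frameMatrix (unitFst (smoothPow p (x 0)) (smoothPow p (x 1)))
    (unitFst (smoothPow p (x 1)) (smoothPow p (x 0)))
    (unitFst (smoothPow (p + q) (x 0)) (smoothPow q (x 1)))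
    (unitFst (smoothPow q (x 1)) (smoothPow (p + q) (x 0)))

theorem frameFun_mem (p q : ℤ) {x : C2} (hx : x ≠ 0) :
    frameFun p q x ∈ Matrix.specialUnitaryGroup (Fin 3) ℂ :=
  frameMatrix_mem (unitFst.unit (smoothPow_ne_zero hx p p))
    (unitFst.unit (smoothPow_ne_zero hx (p + q) q))

/-- The entries a, b have weight p, while s has weight p + q and t has weight q. Conjugation negates
weights, so the second row has weight (p + q) - p = q throughout and the third has weight -p - q. -/
theorem frameFun_smul (p q : ℤ) (z : Circle) (x : C2) :
    frameFun p q ((z : ℂ) • x) = (torusHom p q z).1 * frameFun p q x := by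
  have h (n : ℤ) (i : Fin 2) :
      smoothPow n (((z : ℂ) • x) i) = (z ^ n : Circle) * smoothPow n (x i) := by
    rw [PiLp.smul_apply, smul_eq_mul, smoothPow.map_mul, smoothPow.coe_circle]
  have hs : z ^ (-p - q) = (z ^ p)⁻¹ * (z ^ q)⁻¹ := by
    rw [← zpow_neg, ← zpow_neg, ← zpow_add, sub_eq_add_neg]
  have hpq : z ^ (p + q) = z ^ p * z ^ q := zpow_add z p q
  have ht : (torusHom p q z).1 = Matrix.diagonal ![((z ^ p : Circle) : ℂ), ((z ^ q : Circle) : ℂ),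
    ((z ^ (-p - q) : Circle) : ℂ)] := rfl
  have hu (w : Circle) : (w : ℂ) * (starRingEnd ℂ) w = 1 := by
    rw [← Circle.coe_inv_eq_conj, ← Circle.coe_mul, mul_inv_cancel, Circle.coe_one]
  rw [ht, hs, Circle.coe_mul, Circle.coe_inv_eq_conj, Circle.coe_inv_eq_conj]
  unfold frameFun
  simp only [h, unitFst.mul_circle, hpq]
  simp only [Circle.coe_mul]
  generalize (z ^ p) = u
  generalize (z ^ q) = w
  generalize unitFst (smoothPow p (x 0)) (smoothPow p (x 1)) = a
  generalize unitFst (smoothPow p (x 1)) (smoothPow p (x 0)) = b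
  generalize unitFst (smoothPow (p + q) (x 0)) (smoothPow q (x 1)) = s
  generalize unitFst (smoothPow q (x 1)) (smoothPow (p + q) (x 0)) = t
  ext i j
  rw [Matrix.diagonal_mul]
  fin_cases i <;> fin_cases j <;> simp [frameMatrix]
  · linear_combination (w * s * (starRingEnd ℂ) b) * hu u
  · linear_combination (w * s * (starRingEnd ℂ) a) * hu u
  · ring
  · ring

open Classical in
/-- The map from the punctured plane to `SU(3)` given by `frameFun`. -/
noncomputable def frame (p q : ℤ) (x : C2) : SU3 :=
  if hx : x ≠ 0 then ⟨frameFun p q x, frameFun_mem p q hx⟩ else 1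

theorem frame_val {p q : ℤ} {x : C2} (hx : x ≠ 0) : (frame p q x).1 = frameFun p q x := by
  rw [frame, dif_pos hx]

theorem circle_smul_ne_zero (z : Circle) {x : C2} (hx : x ≠ 0) : (z : ℂ) • x ≠ 0 :=
  smul_ne_zero z.coe_ne_zero hx

theorem frame_smul (p q : ℤ) (z : Circle) {x : C2} (hx : x ≠ 0) :
    frame p q ((z : ℂ) • x) = torusHom p q z * frame p q x := by
  refine Subtype.ext ?_
  rw [frame_val (circle_smul_ne_zero z hx), frameFun_smul]
  change _ = (torusHom p q z).1 * (frame p q x).1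
  rw [frame_val hx]

theorem contDiffOn_frameFun (p q : ℤ) (i j : Fin 3) :
    ContDiffOn ℝ ∞ (fun x => frameFun p q x i j) {0}ᶜ := by
  have hc (n : ℤ) (i : Fin 2) : ContDiffOn ℝ ∞ (fun x : C2 => smoothPow n (x i)) {0}ᶜ := by
    refine ((smoothPow.contDiff n).comp ?_).contDiffOn
    exact (EuclideanSpace.proj (𝕜 := ℂ) i).contDiff.restrict_scalars ℝ
  have ha := unitFst.contDiffOn (hc p 0) (hc p 1) fun x hx => smoothPow_ne_zero hx p p
  have hb := unitFst.contDiffOn (hc p 1) (hc p 0) fun x hx => (smoothPow_ne_zero hx p p).symm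
  have hs := unitFst.contDiffOn (hc (p + q) 0) (hc q 1) fun x hx => smoothPow_ne_zero hx (p + q) q
  have ht := unitFst.contDiffOn (hc q 1) (hc (p + q) 0)
    fun x hx => (smoothPow_ne_zero hx (p + q) q).symm
  have hstar {f : C2 → ℂ} (hf : ContDiffOn ℝ ∞ f {0}ᶜ) :
      ContDiffOn ℝ ∞ (fun x => star (f x)) {0}ᶜ :=
    Complex.conjCLE.contDiff.comp_contDiffOn hf
  unfold frameFun frameMatrix
  fin_cases i <;> fin_cases j
  · exact ha
  · exact hb
  · exact contDiffOn_const
  · exact (hs.mul (hstar hb)).neg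
  · exact hs.mul (hstar ha)
  · exact ht
  · exact (hstar hb).mul (hstar ht)
  · exact ((hstar ha).mul (hstar ht)).neg
  · exact hstar hs

theorem contMDiffOn_frame (p q : ℤ) : ContMDiffOn 𝓘(ℝ, C2) (𝓡 8) ∞ (frame p q) {0}ᶜ := by
  refine SU3.contMDiffOn_of_val (ContDiffOn.contMDiffOn ?_)
  refine contDiffOn_pi.2 fun i => contDiffOn_pi.2 fun j => ?_
  refine (contDiffOn_frameFun p q i j).congr fun x hx => ?_
  exact congrFun (congrFun (frame_val hx) i) j

/-- A smooth map with invertible derivative at a point restricts to a diffeomorphism from a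
neighbourhood of the point. -/
theorem exists_openPartialHomeomorph_contDiffOn_symm {E F : Type*} [NormedAddCommGroup E]
    [NormedSpace ℝ E] [NormedAddCommGroup F] [NormedSpace ℝ F] [CompleteSpace E]
    {f : E → F} {U : Set E} (hU : IsOpen U) (hf : ContDiffOn ℝ ∞ f U) {a : E} (ha : a ∈ U)
    {L : E ≃L[ℝ] F} (hL : HasFDerivAt f (L : E →L[ℝ] F) a) :
    ∃ e : OpenPartialHomeomorph E F, ⇑e = f ∧ a ∈ e.source ∧ e.source ⊆ U ∧
      ContDiffOn ℝ ∞ e.symm e.target := by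
  have hfa : ContDiffAt ℝ ∞ f a := hf.contDiffAt (hU.mem_nhds ha)
  let e₀ := hfa.toOpenPartialHomeomorph f hL (by simp)
  have hcont : ContinuousOn (fderiv ℝ f) U :=
    hf.continuousOn_fderiv_of_isOpen hU (by simp)
  -- The inverse is differentiated at every point of the target, so the source is cut down to the
  -- open set where the derivative of `f` is invertible.
  let W : Set E := U ∩ fderiv ℝ f ⁻¹' Set.range ((↑) : (E ≃L[ℝ] F) → (E →L[ℝ] F))
  have hW : IsOpen W := hcont.isOpen_inter_preimage hU ContinuousLinearEquiv.isOpen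
  have hsrc : (e₀.restr W).source = e₀.source ∩ W := by
    rw [OpenPartialHomeomorph.restr_source, hW.interior_eq]
  refine ⟨e₀.restr W, rfl, ?_, ?_, ?_⟩
  · rw [hsrc]
    exact ⟨hfa.mem_toOpenPartialHomeomorph_source hL (by simp), ha, L, hL.fderiv.symm⟩
  · rw [hsrc]
    exact fun x hx => hx.2.1
  · intro y hy
    have hy' := (e₀.restr W).map_target hy
    rw [hsrc] at hy'
    obtain ⟨-, hyU, L', hL'⟩ := hy'
    have hfy : ContDiffAt ℝ ∞ f ((e₀.restr W).symm y) := hf.contDiffAt (hU.mem_nhds hyU)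
    refine ((e₀.restr W).contDiffAt_symm hy (f₀' := L') ?_ hfy).contDiffWithinAt
    rw [hL']
    exact (hfy.differentiableAt (by simp)).hasFDerivAt

/-! ### Slices for one-parameter subgroups -/

/-- A slice at `1` for the action of `U(1)` on `SU(3)` by right multiplication through `α`: an
identification of an invariant neighbourhood of `1` with `target × U(1)`. -/
structure Slice (α : Circle →* SU3) where
  source : Set SU3
  target : Set (EuclideanSpace ℝ (Fin 7))
  coord : SU3 → EuclideanSpace ℝ (Fin 7)
  phase : SU3 → Circle
  sec : EuclideanSpace ℝ (Fin 7) → SU3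
  isOpen_source : IsOpen source
  isOpen_target : IsOpen target
  one_mem : 1 ∈ source
  phase_one : phase 1 = 1
  sec_mul_mem : ∀ {v}, v ∈ target → ∀ z, sec v * α z ∈ source
  coord_sec_mul : ∀ {v}, v ∈ target → ∀ z, coord (sec v * α z) = v
  phase_sec_mul : ∀ {v}, v ∈ target → ∀ z, phase (sec v * α z) = z
  coord_mem : ∀ {g}, g ∈ source → coord g ∈ target
  sec_coord_mul : ∀ {g}, g ∈ source → sec (coord g) * α (phase g) = g
  contMDiffOn_coord : ContMDiffOn (𝓡 8) (𝓡 7) ∞ coord source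
  contMDiffOn_phase : ContMDiffOn (𝓡 8) 𝓘(ℝ, ℂ) ∞ (fun g => (phase g : ℂ)) source
  contMDiffOn_sec : ContMDiffOn (𝓡 7) (𝓡 8) ∞ sec target

/-! ### Phases, and coordinates transverse to the subgroup -/

namespace torusHom

variable (p q : ℤ)

theorem val_apply (z : Circle) : SU3.val (torusHom p q z) =
    Matrix.diagonal ![smoothPow p z, smoothPow q z, smoothPow (-p - q) z] := by
  simp only [smoothPow.coe_circle]
  rfl

/-- A smooth extension of `torusHom p q` to the complex plane. -/
noncomputable def ext (z : ℂ) : SU3.Amb :=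
  Matrix.diagonal ![smoothPow p z, smoothPow q z, smoothPow (-p - q) z]

theorem contDiff_ext : ContDiff ℝ ∞ (ext p q) := by
  refine contDiff_pi.2 fun i => contDiff_pi.2 fun j => ?_
  have h1 := smoothPow.contDiff p
  have h2 := smoothPow.contDiff q
  have h3 := smoothPow.contDiff (-p - q)
  fin_cases i <;> fin_cases j <;> first | exact h1 | exact h2 | exact h3 | exact contDiff_const

theorem contMDiffOn_comp {E H N : Type*} [NormedAddCommGroup E] [NormedSpace ℝ E]
    [TopologicalSpace H] {I : ModelWithCorners ℝ E H} [TopologicalSpace N] [ChartedSpace H N]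
    {f : N → Circle} {s : Set N} (hf : ContMDiffOn I 𝓘(ℝ, ℂ) ∞ (fun x => (f x : ℂ)) s) :
    ContMDiffOn I (𝓡 8) ∞ (fun x => torusHom p q (f x)) s := by
  refine SU3.contMDiffOn_of_val ?_
  simp only [val_apply]
  exact (contDiff_ext p q).contMDiff.comp_contMDiffOn hf

variable {p q} {m n : ℤ}

/-- The complex number whose direction is the phase of `g`. -/
noncomputable def weight (m n : ℤ) (g : SU3) : ℂ :=
  smoothPow m (g.1 0 0) * smoothPow n (g.1 1 1)

/-- The phase of an element of `SU(3)` with nonzero entries in the first two diagonal places. -/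
noncomputable def phase (m n : ℤ) (g : SU3) : Circle := Circle.exp (weight m n g).arg

/-- The set where the phase is well behaved. -/
def phaseDomain (m n : ℤ) : Set SU3 := {g | weight m n g ≠ 0}

theorem contMDiff_weight : ContMDiff (𝓡 8) 𝓘(ℝ, ℂ) ∞ (weight m n) := by
  have h (X : SU3.Amb → ℂ) (hX : ContDiff ℝ ∞ X) : ContMDiff (𝓡 8) 𝓘(ℝ, ℂ) ∞ (X ∘ SU3.val) :=
    hX.contMDiff.comp SU3.contMDiff_val
  exact h (fun X => smoothPow m (X 0 0) * smoothPow n (X 1 1))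
    (((smoothPow.contDiff m).comp (SU3.contDiff_entry 0 0)).mul
      ((smoothPow.contDiff n).comp (SU3.contDiff_entry 1 1)))

theorem isOpen_phaseDomain : IsOpen (phaseDomain m n) :=
  isOpen_ne_fun contMDiff_weight.continuous continuous_const

theorem weight_one : weight m n 1 = 1 := by
  have h (n : ℤ) : smoothPow n 1 = 1 := by simpa using smoothPow.coe_circle n 1
  simp [weight, h]

theorem one_mem_phaseDomain : 1 ∈ phaseDomain m n := by
  simp [phaseDomain, weight_one]

theorem phase_one : phase m n 1 = 1 := by
  simp [phase, weight_one]

/-- Although the argument jumps across the negative axis, the phase is just the weight divided by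
its absolute value. This form is smooth wherever the weight does not vanish. -/
theorem coe_phase {g : SU3} (hg : g ∈ phaseDomain m n) :
    (phase m n g : ℂ) = unitFst (weight m n g) 0 := by
  rw [phase, Circle.coe_exp, unitFst]
  have h := Complex.norm_mul_exp_arg_mul_I (weight m n g)
  have h0 : (‖weight m n g‖ : ℂ) ≠ 0 := by
    exact Complex.ofReal_ne_zero.2 (norm_ne_zero_iff.2 hg)
  conv_rhs => rw [← h]
  have h1 : √(Complex.normSq (↑‖weight m n g‖ * Complex.exp (↑(weight m n g).arg * Complex.I)) +
      Complex.normSq 0) = ‖weight m n g‖ := by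
    rw [h, Complex.normSq_zero, add_zero]
    rfl
  rw [h1, Complex.ofReal_inv]
  field_simp

theorem contMDiffOn_phase :
    ContMDiffOn (𝓡 8) 𝓘(ℝ, ℂ) ∞ (fun g => (phase m n g : ℂ)) (phaseDomain m n) := by
  have h1 : ContDiffOn ℝ ∞ (fun z : ℂ => unitFst z 0) {0}ᶜ :=
    unitFst.contDiffOn contDiffOn_id contDiffOn_const fun x hx => Or.inl hx
  exact (h1.contMDiffOn.comp contMDiff_weight.contMDiffOn fun g hg => hg).congr
    fun g hg => coe_phase hg

/-- The diagonal entries pick up z^p and z^q, so the weight picks up z^(mp + nq), which is z by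
Bézout. -/
theorem weight_mul (h : m * p + n * q = 1) (g : SU3) (z : Circle) :
    weight m n (g * torusHom p q z) = z * weight m n g := by
  have h0 : (g * torusHom p q z).1 = g.1 * Matrix.diagonal ![((z ^ p : Circle) : ℂ),
    ((z ^ q : Circle) : ℂ), ((z ^ (-p - q) : Circle) : ℂ)] := rfl
  have h1 : z ^ (p * m) * z ^ (q * n) = z := by
    rw [← zpow_add, mul_comm p, mul_comm q, h, zpow_one]
  rw [weight, h0, Matrix.mul_diagonal, Matrix.mul_diagonal, smoothPow.map_mul, smoothPow.map_mul]
  change _ * smoothPow m ((z ^ p : Circle) : ℂ) * (_ * smoothPow n ((z ^ q : Circle) : ℂ)) = _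
  rw [smoothPow.coe_circle, smoothPow.coe_circle, ← zpow_mul, ← zpow_mul, weight]
  have h2 := congrArg (fun w : Circle => (w : ℂ)) h1
  simp only [Circle.coe_mul] at h2
  linear_combination (smoothPow m (g.1 0 0) * smoothPow n (g.1 1 1)) * h2

theorem mul_mem_phaseDomain (h : m * p + n * q = 1) {g : SU3} (hg : g ∈ phaseDomain m n)
    (z : Circle) :
    g * torusHom p q z ∈ phaseDomain m n := by
  change weight m n _ ≠ 0
  rw [weight_mul h]
  exact mul_ne_zero z.coe_ne_zero hg

theorem phase_mul (h : m * p + n * q = 1) {g : SU3} (hg : g ∈ phaseDomain m n) (z : Circle) :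
    phase m n (g * torusHom p q z) = z * phase m n g := by
  refine Circle.ext ?_
  rw [Circle.coe_mul, coe_phase (mul_mem_phaseDomain h hg z), coe_phase hg, weight_mul h,
    ← unitFst.mul_circle z 1, mul_zero]

/-- The translate of `g` along its `U(1)`-orbit that has phase `1`. -/
noncomputable def retract (p q m n : ℤ) (g : SU3) : SU3 := g * (torusHom p q (phase m n g))⁻¹

theorem retract_eq_mul (g : SU3) : retract p q m n g = g * torusHom p q (phase m n g)⁻¹ := by
  rw [retract, map_inv]

theorem retract_mul_phase (g : SU3) : retract p q m n g * torusHom p q (phase m n g) = g := by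
  simp [retract]

theorem retract_of_phase_eq_one {g : SU3} (hg : phase m n g = 1) : retract p q m n g = g := by
  simp [retract, hg]

theorem retract_mem (h : m * p + n * q = 1) {g : SU3} (hg : g ∈ phaseDomain m n) :
    retract p q m n g ∈ phaseDomain m n := by
  rw [retract_eq_mul]
  exact mul_mem_phaseDomain h hg _

theorem phase_retract (h : m * p + n * q = 1) {g : SU3} (hg : g ∈ phaseDomain m n) :
    phase m n (retract p q m n g) = 1 := by
  rw [retract_eq_mul, phase_mul h hg, inv_mul_cancel]

theorem retract_mul (h : m * p + n * q = 1) {g : SU3} (hg : g ∈ phaseDomain m n) (z : Circle) :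
    retract p q m n (g * torusHom p q z) = retract p q m n g := by
  rw [retract, retract, phase_mul h hg, mul_comm z, map_mul]
  group

theorem contMDiffOn_retract :
    ContMDiffOn (𝓡 8) (𝓡 8) ∞ (retract p q m n) (phaseDomain m n) :=
  contMDiffOn_id.mul (contMDiffOn_comp p q contMDiffOn_phase).inv

/-- Linear coordinates on `ℝ⁸` adapted to the tangent vector of `torusHom p q`. -/
noncomputable def splitting (h : m * p + n * q = 1) :
    (EuclideanSpace ℝ (Fin 7) × ℝ) ≃L[ℝ] EuclideanSpace ℝ (Fin 8) :=
  LinearEquiv.toContinuousLinearEquiv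
    -- On the first two coordinates this is the matrix with rows (n, p) and (-m, q). Its determinant
    -- is mp + nq = 1, and its second column (p, q) is the velocity of the subgroup at `1`.
    { toFun := fun x => !₂[n * x.1 0 + p * x.2, -m * x.1 0 + q * x.2,
        x.1 1, x.1 2, x.1 3, x.1 4, x.1 5, x.1 6]
      invFun := fun w => (!₂[q * w 0 - p * w 1, w 2, w 3, w 4, w 5, w 6, w 7], m * w 0 + n * w 1)
      map_add' := fun x y => by
        ext i
        fin_cases i <;> simp <;> ring
      map_smul' := fun c x => by
        ext i
        fin_cases i <;> simp <;> ring
      left_inv := fun x => by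
        have h' : (m * p + n * q : ℝ) = 1 := by exact_mod_cast h
        refine Prod.ext ?_ ?_
        · ext i
          fin_cases i <;> simp
          linear_combination (x.1 0) * h'
        · simp
          linear_combination x.2 * h'
      right_inv := fun w => by
        have h' : (m * p + n * q : ℝ) = 1 := by exact_mod_cast h
        ext i
        fin_cases i <;> simp
        · linear_combination (w 0) * h'
        · linear_combination (w 1) * h' }

theorem splitting_apply (h : m * p + n * q = 1) (x : EuclideanSpace ℝ (Fin 7) × ℝ) :
    splitting h x = !₂[n * x.1 0 + p * x.2, -m * x.1 0 + q * x.2,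
        x.1 1, x.1 2, x.1 3, x.1 4, x.1 5, x.1 6] := rfl

end torusHom

/-! ### The chart of SU(3) at the identity -/

namespace SU3

theorem coordA_val_one : coordA (val 1) = 0 := by
  change coord (1 : Matrix (Fin 3) (Fin 3) ℂ) = 0
  ext i
  fin_cases i <;> simp [coord, Matrix.trace_fin_three]

theorem str_val_one : str (val 1) = 0 := by
  rw [str_val, coordA_val_one, map_zero]

theorem zero_mem_strChart_target : (0 : Amb) ∈ strChart.target := by
  rw [← str_val_one]
  exact strChart.map_source val_one_mem_source

theorem strChart_symm_zero : strChart.symm 0 = val 1 := by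
  rw [← str_val_one]
  exact strChart.left_inv val_one_mem_source

theorem hasFDerivAt_strChart_symm :
    HasFDerivAt strChart.symm ((ContinuousLinearEquiv.refl ℝ Amb).symm : Amb →L[ℝ] Amb) 0 := by
  refine strChart.hasFDerivAt_symm zero_mem_strChart_target ?_
  rw [strChart_symm_zero]
  exact hasFDerivAt_str

theorem chartOneInv_zero : chartOneInv 0 = 1 := by
  refine val_injective ?_
  rw [val_chartOneInv, map_zero, strChart_symm_zero]
  rw [map_zero]
  exact zero_mem_strChart_target

end SU3

/-! ### Derivative of the parametrization by slice and subgroup -/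

namespace torusHom

variable {p q m n : ℤ}

/-- The matrix entries of a local parametrization of `SU(3)` by a slice and the subgroup. -/
noncomputable def flowMatrix (h : m * p + n * q = 1) (x : EuclideanSpace ℝ (Fin 7) × ℝ) :
    SU3.Amb := fun i j => SU3.strChart.symm (SU3.ofCoordA (splitting h (x.1, 0))) i j *
      Complex.exp ((![p, q, -p - q] j : ℤ) * x.2 * Complex.I)

/-- The linear part of `flowMatrix`. -/
noncomputable def flowLin (h : m * p + n * q = 1) :
    EuclideanSpace ℝ (Fin 7) × ℝ →L[ℝ] SU3.Amb :=
  SU3.ofCoordA ∘L ((splitting h : EuclideanSpace ℝ (Fin 7) × ℝ →L[ℝ] EuclideanSpace ℝ (Fin 8)) ∘L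
    (ContinuousLinearMap.inl ℝ (EuclideanSpace ℝ (Fin 7)) ℝ ∘L
      ContinuousLinearMap.fst ℝ (EuclideanSpace ℝ (Fin 7)) ℝ))

theorem flowLin_apply (h : m * p + n * q = 1) (x : EuclideanSpace ℝ (Fin 7) × ℝ) :
    flowLin h x = SU3.ofCoordA (splitting h (x.1, 0)) := rfl

theorem hasFDerivAt_cexp_snd (k : ℤ) : HasFDerivAt (fun x : EuclideanSpace ℝ (Fin 7) × ℝ =>
      Complex.exp (k * x.2 * Complex.I))
      ((ContinuousLinearMap.snd ℝ (EuclideanSpace ℝ (Fin 7)) ℝ).smulRight (k * Complex.I)) 0 := by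
  have h1 : HasDerivAt (fun t : ℝ => Complex.exp (k * t * Complex.I)) (k * Complex.I)
      (0 : EuclideanSpace ℝ (Fin 7) × ℝ).2 := by
    have h2 : HasDerivAt (fun t : ℝ => (k * t * Complex.I : ℂ)) (k * Complex.I) 0 := by
      simpa using ((Complex.ofRealCLM.hasDerivAt (x := (0 : ℝ))).const_mul (k : ℂ)).mul_const
        Complex.I
    simpa using h2.cexp
  refine (h1.hasFDerivAt.comp (0 : EuclideanSpace ℝ (Fin 7) × ℝ)
    (hasFDerivAt_snd (𝕜 := ℝ) (p := (0 : EuclideanSpace ℝ (Fin 7) × ℝ)))).congr_fderiv ?_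
  ext <;> simp

/-- At the origin both factors are the identity matrix, so the product rule adds the slice
direction, where `strChart.symm` has derivative the identity, and i t diag(p, q, -p-q). In
coordinates the latter is t times the second column of `splitting`. -/
theorem hasFDerivAt_flowMatrix (h : m * p + n * q = 1) :
    HasFDerivAt (fun x => SU3.coordA (flowMatrix h x))
      (splitting h : EuclideanSpace ℝ (Fin 7) × ℝ →L[ℝ] EuclideanSpace ℝ (Fin 8)) 0 := by
  have hS : HasFDerivAt (fun x => SU3.strChart.symm (flowLin h x)) (flowLin h) 0 := by
    have h2 := SU3.hasFDerivAt_strChart_symm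
    rw [← map_zero (flowLin h)] at h2
    exact h2.comp 0 (flowLin h).hasFDerivAt
  have hS0 : SU3.strChart.symm (flowLin h 0) = SU3.val 1 := by
    rw [map_zero, SU3.strChart_symm_zero]
  have hM : HasFDerivAt (flowMatrix h) (ContinuousLinearMap.pi fun i =>
      ContinuousLinearMap.pi fun j =>
        (SU3.val 1 i j) • ((ContinuousLinearMap.snd ℝ (EuclideanSpace ℝ (Fin 7)) ℝ).smulRight
          ((![p, q, -p - q] j : ℤ) * Complex.I)) +
        (ContinuousLinearMap.proj j ∘L (ContinuousLinearMap.proj (R := ℝ) i ∘L flowLin h) :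
          EuclideanSpace ℝ (Fin 7) × ℝ →L[ℝ] ℂ)) 0 := by
    refine hasFDerivAt_pi.2 fun i => hasFDerivAt_pi.2 fun j => ?_
    have h1 := hasFDerivAt_pi'.1 (hasFDerivAt_pi'.1 hS i) j
    refine (h1.mul (hasFDerivAt_cexp_snd (![p, q, -p - q] j))).congr_fderiv ?_
    rw [hS0]
    simp
  refine (SU3.coordA.hasFDerivAt.comp 0 hM).congr_fderiv ?_
  refine ContinuousLinearMap.ext fun x => ?_
  change SU3.coord _ = splitting h x
  ext i
  fin_cases i <;> simp [SU3.coord, flowLin_apply, splitting_apply, Matrix.trace_fin_three,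
    SU3.ofCoordA, SU3.val, SU3.ofCoord] <;> ring

end torusHom

/-! ### Construction of the slice -/

namespace torusHom

variable {p q m n : ℤ}

/-- The slice through `1` transverse to `torusHom p q`. -/
noncomputable def linSec (h : m * p + n * q = 1) (v : EuclideanSpace ℝ (Fin 7)) : SU3 :=
  SU3.chartOneInv (splitting h (v, 0))

/-- The domain of the slice `linSec`. -/
def linDomain (h : m * p + n * q = 1) : Set (EuclideanSpace ℝ (Fin 7)) :=
  {v | SU3.ofCoordA (splitting h (v, 0)) ∈ SU3.strChart.target}

theorem isOpen_linDomain (h : m * p + n * q = 1) : IsOpen (linDomain h) :=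
  SU3.strChart.open_target.preimage (by fun_prop)

theorem zero_mem_linDomain (h : m * p + n * q = 1) : 0 ∈ linDomain h := by
  change SU3.ofCoordA (splitting h (0, 0)) ∈ SU3.strChart.target
  rw [Prod.mk_zero_zero, map_zero, map_zero]
  exact SU3.zero_mem_strChart_target

theorem linSec_zero (h : m * p + n * q = 1) : linSec h 0 = 1 := by
  rw [linSec, Prod.mk_zero_zero, map_zero, SU3.chartOneInv_zero]

theorem val_linSec (h : m * p + n * q = 1) {v : EuclideanSpace ℝ (Fin 7)} (hv : v ∈ linDomain h) :
    SU3.val (linSec h v) = SU3.strChart.symm (SU3.ofCoordA (splitting h (v, 0))) :=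
  SU3.val_chartOneInv hv

theorem contDiffOn_strChart_symm (h : m * p + n * q = 1) :
    ContDiffOn ℝ ∞ (fun v => SU3.strChart.symm (SU3.ofCoordA (splitting h (v, 0))))
      (linDomain h) := by
  refine SU3.contDiffOn_symm.comp ?_ fun v hv => hv
  exact (SU3.ofCoordA.contDiff.comp ((splitting h).contDiff.comp
    (contDiff_id.prodMk contDiff_const))).contDiffOn

theorem contMDiffOn_linSec (h : m * p + n * q = 1) :
    ContMDiffOn (𝓡 7) (𝓡 8) ∞ (linSec h) (linDomain h) :=
  SU3.contMDiffOn_of_val ((contDiffOn_strChart_symm h).contMDiffOn.congr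
    fun _ hv => val_linSec h hv)

/-- The local parametrization of `SU(3)` by the slice and the subgroup. -/
noncomputable def flow (h : m * p + n * q = 1) (x : EuclideanSpace ℝ (Fin 7) × ℝ) : SU3 :=
  linSec h x.1 * torusHom p q (Circle.exp x.2)

/-- The inverse function theorem is applied to the coordinates of `flowMatrix`, a map between normed
spaces. This identity carries the result over to `flow`. -/
theorem val_flow (h : m * p + n * q = 1) {x : EuclideanSpace ℝ (Fin 7) × ℝ}
    (hx : x.1 ∈ linDomain h) : SU3.val (flow h x) = flowMatrix h x := by
  funext i j
  have h1 : SU3.val (flow h x) i j = SU3.val (linSec h x.1) i j *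
      ![((Circle.exp x.2 ^ p : Circle) : ℂ), ((Circle.exp x.2 ^ q : Circle) : ℂ),
        ((Circle.exp x.2 ^ (-p - q) : Circle) : ℂ)] j := Matrix.mul_diagonal ..
  rw [h1, val_linSec h hx, flowMatrix]
  congr 1
  have h2 (k : ℤ) : ((Circle.exp x.2 ^ k : Circle) : ℂ) = Complex.exp (k * x.2 * Complex.I) := by
    rw [Circle.coe_zpow, Circle.coe_exp, ← Complex.exp_int_mul, mul_assoc]
  fin_cases j
  · exact h2 p
  · exact h2 q
  · exact h2 (-p - q)

theorem contDiffOn_flowMatrix (h : m * p + n * q = 1) :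
    ContDiffOn ℝ ∞ (flowMatrix h) {x | x.1 ∈ linDomain h} := by
  refine contDiffOn_pi.2 fun i => contDiffOn_pi.2 fun j => ContDiffOn.mul ?_ ?_
  · have h1 := contDiffOn_pi.1 (contDiffOn_pi.1 (contDiffOn_strChart_symm h) i) j
    exact h1.comp contDiff_fst.contDiffOn fun x hx => hx
  · have h2 : ContDiff ℝ ∞ (fun x : EuclideanSpace ℝ (Fin 7) × ℝ => (x.2 : ℂ)) :=
      Complex.ofRealCLM.contDiff.comp contDiff_snd
    exact ((contDiff_const.mul h2).mul contDiff_const).cexp.contDiffOn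

/-- The parametrization `flow` is, near the origin, inverse to a smooth map. -/
theorem exists_flow_chart (h : m * p + n * q = 1) :
    ∃ e : OpenPartialHomeomorph (EuclideanSpace ℝ (Fin 7) × ℝ) (EuclideanSpace ℝ (Fin 8)),
      (0, 0) ∈ e.source ∧ (∀ x ∈ e.source, x.1 ∈ linDomain h ∧
        flow h x ∈ SU3.chartOne.source ∧ e x = SU3.chartOne (flow h x)) ∧
      ContDiffOn ℝ ∞ e.symm e.target := by
  have ho : IsOpen {x : EuclideanSpace ℝ (Fin 7) × ℝ | x.1 ∈ linDomain h} :=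
    (isOpen_linDomain h).preimage continuous_fst
  have hU : IsOpen ({x : EuclideanSpace ℝ (Fin 7) × ℝ | x.1 ∈ linDomain h} ∩
      flowMatrix h ⁻¹' SU3.strChart.source) :=
    (contDiffOn_flowMatrix h).continuousOn.isOpen_inter_preimage ho SU3.strChart.open_source
  have h0 : (0 : EuclideanSpace ℝ (Fin 7) × ℝ) ∈
      ({x : EuclideanSpace ℝ (Fin 7) × ℝ | x.1 ∈ linDomain h} ∩
      flowMatrix h ⁻¹' SU3.strChart.source) := by
    have h1 : (0 : EuclideanSpace ℝ (Fin 7) × ℝ).1 ∈ linDomain h := by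
      rw [Prod.fst_zero]
      exact zero_mem_linDomain h
    refine ⟨h1, ?_⟩
    rw [Set.mem_preimage, ← val_flow h h1, flow, Prod.fst_zero, Prod.snd_zero, linSec_zero,
      Circle.exp_zero, map_one, mul_one]
    exact SU3.val_one_mem_source
  obtain ⟨e, he, h1, h2, h3⟩ := exists_openPartialHomeomorph_contDiffOn_symm hU
    (SU3.coordA.contDiff.comp_contDiffOn
      ((contDiffOn_flowMatrix h).mono Set.inter_subset_left)) h0 (hasFDerivAt_flowMatrix h)
  refine ⟨e, h1, fun x hx => ?_, h3⟩
  obtain ⟨hx1, hx2⟩ := h2 hx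
  refine ⟨hx1, ?_, ?_⟩
  · change SU3.val (flow h x) ∈ SU3.strChart.source
    rw [val_flow h hx1]
    exact hx2
  · rw [he]
    change _ = SU3.coordA (SU3.val (flow h x))
    rw [val_flow h hx1]
    rfl

theorem contMDiff_chartOne : ContMDiff (𝓡 8) (𝓡 8) ∞ (SU3.chartOne : SU3 → _) :=
  SU3.coordA.contDiff.contMDiff.comp SU3.contMDiff_val

/-- The inverse of `flow` gives transverse coordinates only near `1`, whereas a slice must contain
whole U(1)-orbits. So each `g` is first moved along its orbit to phase `1` by `retract`, and the
transverse coordinate is read off there; the phase itself is the U(1)-coordinate. The section is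
`linSec` corrected to phase `1`. -/
theorem exists_slice (h : m * p + n * q = 1) : Nonempty (Slice (torusHom p q)) := by
  obtain ⟨e, he0, he, hes⟩ := exists_flow_chart h
  -- the neighbourhood of `1` parametrized by `flow`
  let N : Set SU3 := SU3.chartOne.source ∩ SU3.chartOne ⁻¹' e.target
  have hN : IsOpen N := SU3.chartOne.isOpen_inter_preimage e.open_target
  have hflow {g : SU3} (hg : g ∈ N) : flow h (e.symm (SU3.chartOne g)) = g := by
    obtain ⟨-, h2, h3⟩ := he _ (e.map_target hg.2)
    refine SU3.chartOne.injOn h2 hg.1 ?_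
    rw [← h3, e.right_inv hg.2]
  let V := phaseDomain m n
  have hV : IsOpen V := isOpen_phaseDomain
  have hcphase : ContinuousOn (fun g => (phase m n g : ℂ)) V := contMDiffOn_phase.continuousOn
  -- Off the negative axis the argument is continuous, which makes `θ` below continuous.
  let V₁ : Set SU3 := V ∩ (fun g => (phase m n g : ℂ)) ⁻¹' Complex.slitPlane
  have hV₁ : IsOpen V₁ := hcphase.isOpen_inter_preimage hV Complex.isOpen_slitPlane
  have hcsec : ContinuousOn (linSec h) (linDomain h) := (contMDiffOn_linSec h).continuousOn
  let T₁ : Set (EuclideanSpace ℝ (Fin 7)) := linDomain h ∩ linSec h ⁻¹' V₁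
  have hT₁ : IsOpen T₁ := hcsec.isOpen_inter_preimage (isOpen_linDomain h) hV₁
  let θ : EuclideanSpace ℝ (Fin 7) → ℝ := fun v => -(phase m n (linSec h v) : ℂ).arg
  have hθ : ContinuousOn θ T₁ := by
    refine ContinuousOn.neg (Complex.continuousOn_arg.comp (hcphase.comp
      (hcsec.mono Set.inter_subset_left) fun v hv => hv.2.1) fun v hv => hv.2.2)
  -- For such `v` the point of phase `1` on the orbit of `linSec h v`, namely `flow h (v, θ v)`, is
  -- still within reach of the local inverse `e.symm`.
  let T : Set (EuclideanSpace ℝ (Fin 7)) := T₁ ∩ (fun v => (v, θ v)) ⁻¹' e.source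
  have hT : IsOpen T := (continuousOn_id.prodMk hθ).isOpen_inter_preimage hT₁ e.open_source
  let k : SU3 → EuclideanSpace ℝ (Fin 7) :=
    fun g => (e.symm (SU3.chartOne (retract p q m n g))).1
  have hcret : ContinuousOn (retract p q m n) V := contMDiffOn_retract.continuousOn
  let S₁ : Set SU3 := V ∩ retract p q m n ⁻¹' N
  have hS₁ : IsOpen S₁ := hcret.isOpen_inter_preimage hV hN
  have hk : ContMDiffOn (𝓡 8) (𝓡 7) ∞ k S₁ := by
    have h1 : ContMDiffOn (𝓡 8) (𝓡 8) ∞ (fun g => SU3.chartOne (retract p q m n g)) S₁ :=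
      contMDiff_chartOne.comp_contMDiffOn (contMDiffOn_retract.mono Set.inter_subset_left)
    exact (contDiff_fst.comp_contDiffOn hes).contMDiffOn.comp h1 fun g hg => hg.2.2
  let S : Set SU3 := S₁ ∩ k ⁻¹' T
  have hS : IsOpen S := hk.continuousOn.isOpen_inter_preimage hS₁ hT
  have hret {v : EuclideanSpace ℝ (Fin 7)} :
      retract p q m n (linSec h v) = flow h (v, θ v) := by
    rw [flow, retract_eq_mul]
    congr 2
    rw [Circle.exp_neg, Circle.exp_arg]
  have hretN {v : EuclideanSpace ℝ (Fin 7)} (hv : v ∈ T) :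
      retract p q m n (linSec h v) ∈ N ∧
      e.symm (SU3.chartOne (retract p q m n (linSec h v))) = (v, θ v) := by
    obtain ⟨-, h2, h3⟩ := he _ hv.2
    rw [hret]
    refine ⟨⟨h2, ?_⟩, ?_⟩
    · rw [Set.mem_preimage, ← h3]
      exact e.map_source hv.2
    · rw [← h3, e.left_inv hv.2]
  have hsecV {v : EuclideanSpace ℝ (Fin 7)} (hv : v ∈ T) : linSec h v ∈ V := hv.1.2.1
  have hkmul {v : EuclideanSpace ℝ (Fin 7)} (hv : v ∈ T) (z : Circle) :
      retract p q m n (retract p q m n (linSec h v) * torusHom p q z) =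
        retract p q m n (linSec h v) := by
    rw [retract_mul h (retract_mem h (hsecV hv)),
      retract_of_phase_eq_one (phase_retract h (hsecV hv))]
  have hk' {v : EuclideanSpace ℝ (Fin 7)} (hv : v ∈ T) (z : Circle) :
      k (retract p q m n (linSec h v) * torusHom p q z) = v := by
    change (e.symm (SU3.chartOne (retract p q m n _))).1 = v
    rw [hkmul hv, (hretN hv).2]
  have hret1 : retract p q m n 1 = 1 := retract_of_phase_eq_one phase_one
  have hphase1 : (phase m n (linSec h 0) : ℂ) = 1 := by
    rw [linSec_zero, phase_one, Circle.coe_one]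
  have hθ0 : θ 0 = 0 := by
    change -(phase m n (linSec h 0) : ℂ).arg = 0
    rw [hphase1, Complex.arg_one, neg_zero]
  have h0T : 0 ∈ T := by
    refine ⟨⟨zero_mem_linDomain h, ?_, ?_⟩, ?_⟩
    · rw [linSec_zero]
      exact one_mem_phaseDomain
    · rw [Set.mem_preimage, hphase1]
      exact Complex.one_mem_slitPlane
    · rw [Set.mem_preimage, hθ0]
      exact he0
  have hmem {v : EuclideanSpace ℝ (Fin 7)} (hv : v ∈ T) (z : Circle) :
      retract p q m n (linSec h v) * torusHom p q z ∈ S := by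
    refine ⟨⟨mul_mem_phaseDomain h (retract_mem h (hsecV hv)) z, ?_⟩, ?_⟩
    · rw [Set.mem_preimage, hkmul hv]
      exact (hretN hv).1
    · rw [Set.mem_preimage, hk' hv]
      exact hv
  refine ⟨{
    source := S
    target := T
    coord := k
    phase := phase m n
    sec := fun v => retract p q m n (linSec h v)
    isOpen_source := hS
    isOpen_target := hT
    one_mem := ?_
    phase_one := phase_one
    sec_mul_mem := hmem
    coord_sec_mul := hk'
    phase_sec_mul := fun {v} hv z => ?_
    coord_mem := fun {g} hg => hg.2
    sec_coord_mul := fun {g} hg => ?_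
    contMDiffOn_coord := hk.mono Set.inter_subset_left
    contMDiffOn_phase := contMDiffOn_phase.mono fun g hg => hg.1.1
    contMDiffOn_sec := contMDiffOn_retract.comp ((contMDiffOn_linSec h).mono fun v hv => hv.1.1)
      fun v hv => hsecV hv }⟩
  · have := hmem h0T 1
    rwa [linSec_zero, hret1, map_one, mul_one] at this
  · rw [phase_mul h (retract_mem h (hsecV hv)), phase_retract h (hsecV hv), mul_one]
  · have h1 : retract p q m n g = flow h (e.symm (SU3.chartOne (retract p q m n g))) :=
      (hflow hg.1.2).symm
    -- By `h1`, `retract g` lies on the U(1)-orbit of `linSec h (k g)`, and `retract` is constant on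
    -- orbits. On the left it acts trivially, since `retract g` already has phase `1`.
    have h2 : retract p q m n (retract p q m n g) = retract p q m n (linSec h (k g)) := by
      conv_lhs => rw [h1, flow, retract_mul h (hsecV hg.2)]
    rw [retract_of_phase_eq_one (phase_retract h hg.1.1)] at h2
    rw [← h2, retract_mul_phase]

end torusHom

/-! ### Flow boxes for circle actions and smooth structures on quotients -/

section FlowBox

variable {E H N : Type*} [NormedAddCommGroup E] [NormedSpace ℝ E] [TopologicalSpace H]
  [TopologicalSpace N] [ChartedSpace H N] {M : Type*}
  {B : Type*} [NormedAddCommGroup B] [NormedSpace ℝ B]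

/-- A flow box for a map `q : N → M` whose fibres are the orbits of a circle action `act`: an
identification of a saturated open set with `target × U(1)`. -/
structure FlowBox (I : ModelWithCorners ℝ E H) (B : Type*) [NormedAddCommGroup B]
    [NormedSpace ℝ B] (q : N → M) where
  source : Set N
  target : Set B
  coord : N → B
  phase : N → Circle
  sec : B → N
  act : Circle → N → N
  isOpen_source : IsOpen source
  isOpen_target : IsOpen target
  act_sec_mem : ∀ {u}, u ∈ target → ∀ z, act z (sec u) ∈ source
  coord_act_sec : ∀ {u}, u ∈ target → ∀ z, coord (act z (sec u)) = u
  phase_act_sec : ∀ {u}, u ∈ target → ∀ z, phase (act z (sec u)) = z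
  coord_mem : ∀ {x}, x ∈ source → coord x ∈ target
  act_phase_sec : ∀ {x}, x ∈ source → act (phase x) (sec (coord x)) = x
  act_one : ∀ x, act 1 x = x
  map_act : ∀ z x, q (act z x) = q x
  mem_of_map_eq : ∀ {x y}, x ∈ source → q x = q y → y ∈ source
  coord_eq_of_map_eq : ∀ {x y}, x ∈ source → q x = q y → coord x = coord y
  contMDiffOn_coord : ContMDiffOn I 𝓘(ℝ, B) ∞ coord source
  contMDiffOn_phase : ContMDiffOn I 𝓘(ℝ, ℂ) ∞ (fun x => (phase x : ℂ)) source
  contMDiffOn_sec : ContMDiffOn 𝓘(ℝ, B) I ∞ sec target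
  contMDiffOn_act : ContMDiffOn 𝓘(ℝ, B × ℝ) I ∞
    (fun x : B × ℝ => act (Circle.exp x.2) (sec x.1)) {x | x.1 ∈ target}

namespace FlowBox

variable {I : ModelWithCorners ℝ E H} {q : N → M} (b : FlowBox I B q)

theorem sec_mem {u : B} (hu : u ∈ b.target) : b.sec u ∈ b.source := by
  simpa [b.act_one] using b.act_sec_mem hu 1

theorem coord_sec {u : B} (hu : u ∈ b.target) : b.coord (b.sec u) = u := by
  simpa [b.act_one] using b.coord_act_sec hu 1

theorem map_sec_coord {x : N} (hx : x ∈ b.source) : q (b.sec (b.coord x)) = q x := by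
  rw [← b.map_act (b.phase x), b.act_phase_sec hx]

open Classical in
/-- The function on the quotient induced by the coordinate of a flow box. -/
noncomputable def chartFun (m : M) : B :=
  if h : ∃ x ∈ b.source, q x = m then b.coord h.choose else 0

theorem chartFun_map {x : N} (hx : x ∈ b.source) : b.chartFun (q x) = b.coord x := by
  have h : ∃ y ∈ b.source, q y = q x := ⟨x, hx, rfl⟩
  rw [chartFun, dif_pos h]
  exact b.coord_eq_of_map_eq h.choose_spec.1 h.choose_spec.2

/-- The chart of the quotient given by a flow box. -/
noncomputable def chart [TopologicalSpace M] (hq : Continuous q) (hqo : IsOpenMap q) :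
    OpenPartialHomeomorph M B where
  toFun := b.chartFun
  invFun u := q (b.sec u)
  source := q '' b.source
  target := b.target
  map_source' := by
    rintro _ ⟨x, hx, rfl⟩
    rw [b.chartFun_map hx]
    exact b.coord_mem hx
  map_target' u hu := ⟨_, b.sec_mem hu, rfl⟩
  left_inv' := by
    rintro _ ⟨x, hx, rfl⟩
    rw [b.chartFun_map hx, b.map_sec_coord hx]
  right_inv' u hu := by rw [b.chartFun_map (b.sec_mem hu), b.coord_sec hu]
  open_source := hqo _ b.isOpen_source
  open_target := b.isOpen_target
  continuousOn_toFun := by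
    rw [continuousOn_open_iff (hqo _ b.isOpen_source)]
    intro O hO
    have : q '' b.source ∩ b.chartFun ⁻¹' O = q '' (b.source ∩ b.coord ⁻¹' O) := by
      ext m
      constructor
      · rintro ⟨⟨x, hx, rfl⟩, hm⟩
        rw [Set.mem_preimage, b.chartFun_map hx] at hm
        exact ⟨x, ⟨hx, hm⟩, rfl⟩
      · rintro ⟨x, ⟨hx, hm⟩, rfl⟩
        refine ⟨⟨x, hx, rfl⟩, ?_⟩
        rw [Set.mem_preimage, b.chartFun_map hx]
        exact hm
    rw [this]
    exact hqo _ (b.contMDiffOn_coord.continuousOn.isOpen_inter_preimage b.isOpen_source hO)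
  continuousOn_invFun := hq.comp_continuousOn b.contMDiffOn_sec.continuousOn

/-- The chart of the total space given by a flow box. -/
noncomputable def flowChart : OpenPartialHomeomorph N (B × ℝ) where
  toFun x := (b.coord x, (b.phase x : ℂ).arg)
  invFun u := b.act (Circle.exp u.2) (b.sec u.1)
  -- The circle is cut open at `-1`, because the argument is a smooth coordinate only on the slit
  -- plane.
  source := b.source ∩ (fun x => (b.phase x : ℂ)) ⁻¹' Complex.slitPlane
  target := b.target ×ˢ Set.Ioo (-Real.pi) Real.pi
  map_source' x hx := by
    refine ⟨b.coord_mem hx.1, Complex.neg_pi_lt_arg _, ?_⟩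
    exact lt_of_le_of_ne (Complex.arg_le_pi _) (Complex.mem_slitPlane_iff_arg.1 hx.2).1
  map_target' u hu := by
    refine ⟨b.act_sec_mem hu.1 _, ?_⟩
    rw [Set.mem_preimage, b.phase_act_sec hu.1, Complex.mem_slitPlane_iff_arg,
      Circle.arg_exp hu.2.1 hu.2.2.le]
    exact ⟨hu.2.2.ne, Circle.coe_ne_zero _⟩
  left_inv' x hx := by
    simp only [Circle.exp_arg]
    exact b.act_phase_sec hx.1
  right_inv' u hu := by
    simp only [b.coord_act_sec hu.1, b.phase_act_sec hu.1, Circle.arg_exp hu.2.1 hu.2.2.le]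
  open_source := b.contMDiffOn_phase.continuousOn.isOpen_inter_preimage b.isOpen_source
    Complex.isOpen_slitPlane
  open_target := b.isOpen_target.prod isOpen_Ioo
  continuousOn_toFun := (b.contMDiffOn_coord.continuousOn.mono Set.inter_subset_left).prodMk
    (Complex.continuousOn_arg.comp (b.contMDiffOn_phase.continuousOn.mono Set.inter_subset_left)
      fun _ hx => hx.2)
  continuousOn_invFun := b.contMDiffOn_act.continuousOn.mono fun _ hu => hu.1

theorem contDiffOn_arg : ContDiffOn ℝ ∞ Complex.arg Complex.slitPlane := by
  have : ContDiffOn ℝ ∞ (fun z => (Complex.log z).im) Complex.slitPlane := by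
    have h : ContDiffOn ℝ ∞ Complex.log Complex.slitPlane := fun z hz =>
      ((Complex.contDiffAt_log hz).restrict_scalars ℝ).contDiffWithinAt
    exact Complex.imCLM.contDiff.comp_contDiffOn h
  exact this.congr fun z _ => (Complex.log_im z).symm

theorem contMDiffOn_flowChart : ContMDiffOn I 𝓘(ℝ, B × ℝ) ∞ b.flowChart b.flowChart.source :=
  (b.contMDiffOn_coord.mono Set.inter_subset_left).prodMk_space
    (contDiffOn_arg.contMDiffOn.comp (b.contMDiffOn_phase.mono Set.inter_subset_left)
      fun _ hx => hx.2)

theorem contMDiffOn_flowChart_symm :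
    ContMDiffOn 𝓘(ℝ, B × ℝ) I ∞ b.flowChart.symm b.flowChart.target :=
  b.contMDiffOn_act.mono fun _ hu => hu.1

end FlowBox

/-- A criterion for submersions: a chart of the source in which the map is a projection. -/
theorem Manifold.IsSubmersionAtOfComplement.of_flowChart {F : Type*} [NormedAddCommGroup F]
    [NormedSpace ℝ F] {I : ModelWithCorners ℝ E H} [I.Boundaryless] [IsManifold I ∞ N]
    [TopologicalSpace M] [ChartedSpace B M] {f : N → M} {x : N}
    (D : OpenPartialHomeomorph N (B × F)) (hx : x ∈ D.source)
    (hD : ContMDiffOn I 𝓘(ℝ, B × F) ∞ D D.source)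
    (hD' : ContMDiffOn 𝓘(ℝ, B × F) I ∞ D.symm D.target) (L : E ≃L[ℝ] (B × F))
    (c : OpenPartialHomeomorph M B) (hc : c ∈ IsManifold.maximalAtlas 𝓘(ℝ, B) ∞ M)
    (hfc : ∀ y ∈ D.source, f y ∈ c.source ∧ (D y).1 = c (f y)) :
    IsSubmersionAtOfComplement F I 𝓘(ℝ, B) ∞ f x := by
  -- A chart must take values in the model space `H`. Without boundary, `I` is a homeomorphism onto
  -- `E`, so `D` can be transported back through `L` and `I`.
  let φ : OpenPartialHomeomorph N H :=
    D ≫ₕ (L.symm.toHomeomorph.toOpenPartialHomeomorph ≫ₕ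
      I.toHomeomorph.symm.toOpenPartialHomeomorph)
  have hsrc : φ.source = D.source := by simp [φ]
  have htgt : φ.target = {h | L (I h) ∈ D.target} := by
    ext h
    simp [φ]
  refine mk_of_charts L φ c (by rwa [hsrc]) (hfc x hx).1 ?_ hc ?_ ?_
  · refine φ.mem_maximalAtlas_of_contMDiffOn ?_ ?_
    · rw [hsrc]
      have h1 : ContMDiffOn I 𝓘(ℝ, E) ∞ (fun y => L.symm (D y)) D.source :=
        L.symm.contDiff.contMDiff.comp_contMDiffOn hD
      exact I.contMDiffOn_symm.comp h1 fun y _ => by simp [I.range_eq_univ]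
    · rw [htgt]
      have h1 : ContMDiff I 𝓘(ℝ, B × F) ∞ (fun h => L (I h)) :=
        L.contDiff.contMDiff.comp I.contMDiff
      exact hD'.comp h1.contMDiffOn fun h hh => hh
  · rw [hsrc]
    exact fun y hy => (hfc y hy).1
  · intro u hu
    have hu' : L u ∈ D.target := by
      rw [φ.extend_target] at hu
      have := hu.1
      rw [Set.mem_preimage, htgt] at this
      simpa [I.range_eq_univ] using this
    have h1 : (φ.extend I).symm u = D.symm (L u) := by
      change D.symm (L (I (I.symm u))) = _
      rw [I.right_inv (by simp [I.range_eq_univ])]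
    change c (f ((φ.extend I).symm u)) = (L u).1
    rw [h1, ← (hfc _ (D.map_target hu')).2, D.right_inv hu']

end FlowBox

/-! ### Manifolds from compatible flow boxes -/

section FlowAtlas

variable {E H N : Type*} [NormedAddCommGroup E] [NormedSpace ℝ E] [TopologicalSpace H]
  [TopologicalSpace N] [ChartedSpace H N] {M : Type*} [TopologicalSpace M] {ι : Type*}

/-- A family of flow boxes for jointly surjective maps `q i : N → M` that differ by smooth
transition maps. -/
structure FlowAtlas (I : ModelWithCorners ℝ E H) (B : Type*) [NormedAddCommGroup B]
    [NormedSpace ℝ B] (q : ι → N → M) where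
  box : ∀ i : ι, N → FlowBox I B (q i)
  mem_source : ∀ i x, x ∈ (box i x).source
  phase_self : ∀ i x, (box i x).phase x = 1
  continuous_map : ∀ i, Continuous (q i)
  isOpenMap : ∀ i, IsOpenMap (q i)
  exists_map_eq : ∀ m, ∃ i x, q i x = m
  transition : ∀ i j x, q j x ∈ Set.range (q i) → ∃ (G : N → N) (U : Set N), IsOpen U ∧ x ∈ U ∧
    ContMDiffOn I I ∞ G U ∧ ∀ y ∈ U, q i (G y) = q j y

namespace FlowAtlas

variable {B : Type*} [NormedAddCommGroup B] [NormedSpace ℝ B] {I : ModelWithCorners ℝ E H}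
  {q : ι → N → M} (A : FlowAtlas I B q)

/-- The chart of `M` given by a flow box. -/
noncomputable def chart (i : ι) (x : N) : OpenPartialHomeomorph M B :=
  (A.box i x).chart (A.continuous_map i) (A.isOpenMap i)

theorem chart_map {i : ι} {x y : N} (hy : y ∈ (A.box i x).source) :
    A.chart i x (q i y) = (A.box i x).coord y :=
  (A.box i x).chartFun_map hy

theorem mem_chart_source (i : ι) (x : N) : q i x ∈ (A.chart i x).source :=
  ⟨x, A.mem_source i x, rfl⟩

/-- The charted space structure given by an atlas of flow boxes. -/
noncomputable abbrev chartedSpace : ChartedSpace B M where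
  atlas := Set.range fun c : ι × N => A.chart c.1 c.2
  chartAt m := A.chart (A.exists_map_eq m).choose (A.exists_map_eq m).choose_spec.choose
  mem_chart_source m := by
    have := A.mem_chart_source (A.exists_map_eq m).choose (A.exists_map_eq m).choose_spec.choose
    rwa [(A.exists_map_eq m).choose_spec.choose_spec] at this
  chart_mem_atlas m := ⟨(_, _), rfl⟩

/-- Lifting through `transition` replaces `q j` locally by `q i ∘ G`, and a chart composed with `q
i` is the smooth coordinate of its box. Smoothness of chart changes and of the maps `q j` both
reduce to this. -/
theorem contMDiffOn_chart_comp (i j : ι) (x : N) :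
    ContMDiffOn I 𝓘(ℝ, B) ∞ (A.chart i x ∘ q j) (q j ⁻¹' (A.chart i x).source) := by
  rintro y ⟨y', hy', hyy'⟩
  obtain ⟨G, U, hU, hyU, hG, hGq⟩ := A.transition i j y ⟨y', hyy'⟩
  have hGy : G y ∈ (A.box i x).source :=
    (A.box i x).mem_of_map_eq hy' (hyy'.trans (hGq y hyU).symm)
  have hO : IsOpen (U ∩ G ⁻¹' (A.box i x).source) :=
    hG.continuousOn.isOpen_inter_preimage hU (A.box i x).isOpen_source
  have h1 : ContMDiffOn I 𝓘(ℝ, B) ∞ ((A.box i x).coord ∘ G) (U ∩ G ⁻¹' (A.box i x).source) :=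
    (A.box i x).contMDiffOn_coord.comp (hG.mono Set.inter_subset_left) fun _ h => h.2
  refine ContMDiffAt.contMDiffWithinAt ?_
  refine (h1.contMDiffAt (hO.mem_nhds ⟨hyU, hGy⟩)).congr_of_eventuallyEq ?_
  filter_upwards [hO.mem_nhds ⟨hyU, hGy⟩] with w hw
  rw [Function.comp_apply, ← hGq w hw.1, A.chart_map hw.2, Function.comp_apply]

/-- The inverse of a chart is `q` after the smooth section of its box, so a chart change is the
previous map composed with that section. -/
theorem contDiffOn_chart_symm_trans (c c' : ι × N) :
    ContDiffOn ℝ ∞ ((A.chart c.1 c.2).symm ≫ₕ A.chart c'.1 c'.2)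
      ((A.chart c.1 c.2).symm ≫ₕ A.chart c'.1 c'.2).source := by
  have h := (A.contMDiffOn_chart_comp c'.1 c.1 c'.2).comp
    ((A.box c.1 c.2).contMDiffOn_sec.mono
      (t := ((A.chart c.1 c.2).symm ≫ₕ A.chart c'.1 c'.2).source) fun u hu => hu.1)
    fun u hu => hu.2
  exact contMDiffOn_iff_contDiffOn.1 h

theorem isManifold : letI := A.chartedSpace; IsManifold 𝓘(ℝ, B) ∞ M := by
  let := A.chartedSpace
  refine isManifold_of_contDiffOn _ _ _ ?_
  rintro _ _ ⟨c, rfl⟩ ⟨c', rfl⟩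
  simpa using A.contDiffOn_chart_symm_trans c c'

theorem chart_mem_maximalAtlas (i : ι) (x : N) :
    letI := A.chartedSpace; A.chart i x ∈ IsManifold.maximalAtlas 𝓘(ℝ, B) ∞ M := by
  let := A.chartedSpace
  have := A.isManifold
  exact IsManifold.subset_maximalAtlas ⟨(i, x), rfl⟩

theorem contMDiff_map (j : ι) : letI := A.chartedSpace; ContMDiff I 𝓘(ℝ, B) ∞ (q j) := by
  let := A.chartedSpace
  have := A.isManifold
  intro x
  have h1 := A.contMDiffOn_chart_comp j j x
  have h2 := contMDiffOn_symm_of_mem_maximalAtlas (A.chart_mem_maximalAtlas j x)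
  have hO : IsOpen (q j ⁻¹' (A.chart j x).source) :=
    (A.chart j x).open_source.preimage (A.continuous_map j)
  have h3 := h2.comp h1 fun y hy => (A.chart j x).map_source hy
  refine (h3.contMDiffAt (hO.mem_nhds (A.mem_chart_source j x))).congr_of_eventuallyEq ?_
  filter_upwards [hO.mem_nhds (A.mem_chart_source j x)] with y hy
  exact ((A.chart j x).left_inv hy).symm

/-- Smoothness of a map out of `M` can be checked after lifting its argument to `N` by such a
section. -/
theorem exists_section (m : M) : letI := A.chartedSpace;
    ∃ (i : ι) (s : M → N) (U : Set M), IsOpen U ∧ m ∈ U ∧ ContMDiffOn 𝓘(ℝ, B) I ∞ s U ∧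
      ∀ m' ∈ U, q i (s m') = m' := by
  let := A.chartedSpace
  obtain ⟨i, x, rfl⟩ := A.exists_map_eq m
  refine ⟨i, fun m => (A.box i x).sec (A.chart i x m), (A.chart i x).source,
    (A.chart i x).open_source, A.mem_chart_source i x, ?_, fun m' hm' =>
    (A.chart i x).left_inv hm'⟩
  exact (A.box i x).contMDiffOn_sec.comp
    (contMDiffOn_of_mem_maximalAtlas (A.chart_mem_maximalAtlas i x))
    fun m hm => (A.chart i x).map_source hm

/-- In the flow chart upstairs and the box chart downstairs, `q j` is the projection B × ℝ → B. The
box at a point has phase `1` there, so the point avoids the cut of the circle. -/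
theorem isSubmersion [I.Boundaryless] [IsManifold I ∞ N] (L : E ≃L[ℝ] (B × ℝ)) (j : ι) :
    letI := A.chartedSpace; Manifold.IsSubmersion I 𝓘(ℝ, B) ∞ (q j) := by
  let := A.chartedSpace
  refine Manifold.IsSubmersionOfComplement.isSubmersion (F := ℝ) fun x => ?_
  refine .of_flowChart (A.box j x).flowChart ⟨A.mem_source j x, ?_⟩
    (A.box j x).contMDiffOn_flowChart (A.box j x).contMDiffOn_flowChart_symm L (A.chart j x)
    (A.chart_mem_maximalAtlas j x) fun y hy => ⟨⟨y, hy.1, rfl⟩, (A.chart_map hy.1).symm⟩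
  rw [Set.mem_preimage, A.phase_self, Circle.coe_one]
  exact Complex.one_mem_slitPlane

end FlowAtlas

end FlowAtlas

/-! ### Homomorphisms `U(1) → SU(3)` with slices and equivariant maps -/

/-- The data on a homomorphism `α : U(1) → SU(3)` used to build and to glue the tubes
`ℂ² ×_α SU(3)`: a slice, and a smooth map `frame` from the punctured plane that intertwines the
scalar action with left multiplication through `α`. -/
structure TubeData (α : Circle →* SU3) where
  slice : Slice α
  frame : C2 → SU3
  continuous_hom : Continuous α
  contMDiff_exp : ContMDiff 𝓘(ℝ, ℝ) (𝓡 8) ∞ fun t => α (Circle.exp t)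
  contMDiffOn_frame : ContMDiffOn 𝓘(ℝ, C2) (𝓡 8) ∞ frame {0}ᶜ
  frame_smul : ∀ (z : Circle) {x : C2}, x ≠ 0 → frame ((z : ℂ) • x) = α z * frame x

theorem Circle.contDiff_coe_exp : ContDiff ℝ ∞ fun t : ℝ => (Circle.exp t : ℂ) := by
  simp only [Circle.coe_exp]
  exact (Complex.ofRealCLM.contDiff.mul contDiff_const).cexp

theorem torusHom.continuous (p q : ℤ) : Continuous (torusHom p q) := by
  rw [SU3.isInducing_val.continuous_iff]
  have : SU3.val ∘ torusHom p q = fun z : Circle => torusHom.ext p q z :=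
    funext fun z => torusHom.val_apply p q z
  rw [this]
  exact (torusHom.contDiff_ext p q).continuous.comp continuous_subtype_val

theorem exists_tubeData {p q : ℤ} (h : IsCoprime p q) : Nonempty (TubeData (torusHom p q)) := by
  obtain ⟨m, n, hmn⟩ := h
  obtain ⟨S⟩ := torusHom.exists_slice hmn
  refine ⟨⟨S, frame p q, torusHom.continuous p q, ?_, contMDiffOn_frame p q,
    fun z x hx => frame_smul p q z hx⟩⟩
  exact contMDiffOn_univ.1 (torusHom.contMDiffOn_comp p q
    Circle.contDiff_coe_exp.contMDiff.contMDiffOn)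

namespace Slice

variable {α : Circle →* SU3} (S : Slice α)

/-- Writing `g` as `sec v * α w` turns right multiplication by `α z` into the change from `w` to `w
* z`. The two lemmas after this one use the same rewriting. -/
theorem mul_mem {g : SU3} (hg : g ∈ S.source) (z : Circle) : g * α z ∈ S.source := by
  have := S.sec_mul_mem (S.coord_mem hg) (S.phase g * z)
  rwa [map_mul, ← mul_assoc, S.sec_coord_mul hg] at this

theorem coord_mul {g : SU3} (hg : g ∈ S.source) (z : Circle) :
    S.coord (g * α z) = S.coord g := by
  have := S.coord_sec_mul (S.coord_mem hg) (S.phase g * z)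
  rwa [map_mul, ← mul_assoc, S.sec_coord_mul hg] at this

theorem phase_mul {g : SU3} (hg : g ∈ S.source) (z : Circle) :
    S.phase (g * α z) = S.phase g * z := by
  have := S.phase_sec_mul (S.coord_mem hg) (S.phase g * z)
  rwa [map_mul, ← mul_assoc, S.sec_coord_mul hg] at this

end Slice

/-! ### Smooth structure of the coset space -/

namespace TubeData

variable {α : Circle →* SU3} (D : TubeData α)

theorem contMDiff_leftMul (g₀ : SU3) : ContMDiff (𝓡 8) (𝓡 8) ∞ fun g : SU3 => g₀ * g :=
  contMDiff_mul_left

theorem contMDiffOn_sec_mul_exp (g₀ : SU3) :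
    ContMDiffOn 𝓘(ℝ, EuclideanSpace ℝ (Fin 7) × ℝ) (𝓡 8) ∞
      (fun x : EuclideanSpace ℝ (Fin 7) × ℝ => g₀ * D.slice.sec x.1 * α (Circle.exp x.2))
      {x | x.1 ∈ D.slice.target} := by
  have h1 : ContMDiff 𝓘(ℝ, EuclideanSpace ℝ (Fin 7) × ℝ) (𝓡 7) ∞
      (Prod.fst : EuclideanSpace ℝ (Fin 7) × ℝ → EuclideanSpace ℝ (Fin 7)) :=
    contDiff_fst.contMDiff
  have h2 : ContMDiff 𝓘(ℝ, EuclideanSpace ℝ (Fin 7) × ℝ) 𝓘(ℝ, ℝ) ∞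
      (Prod.snd : EuclideanSpace ℝ (Fin 7) × ℝ → ℝ) :=
    contDiff_snd.contMDiff
  exact ((contMDiff_leftMul g₀).comp_contMDiffOn
    (D.slice.contMDiffOn_sec.comp h1.contMDiffOn fun x hx => hx)).mul
      (D.contMDiff_exp.comp h2).contMDiffOn

/-- The flow box at `g₀` of the projection from `SU(3)` to its quotient by `α`. -/
noncomputable def cosetBox (g₀ : SU3) : FlowBox (𝓡 8) (EuclideanSpace ℝ (Fin 7))
    (QuotientGroup.mk : SU3 → SU3 ⧸ α.range) where
  source := (fun g => g₀⁻¹ * g) ⁻¹' D.slice.source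
  target := D.slice.target
  coord g := D.slice.coord (g₀⁻¹ * g)
  phase g := D.slice.phase (g₀⁻¹ * g)
  sec v := g₀ * D.slice.sec v
  act z g := g * α z
  isOpen_source := D.slice.isOpen_source.preimage (continuous_const.mul continuous_id)
  isOpen_target := D.slice.isOpen_target
  act_sec_mem hu z := by
    simpa [mul_assoc] using D.slice.sec_mul_mem hu z
  coord_act_sec hu z := by
    simpa [mul_assoc] using D.slice.coord_sec_mul hu z
  phase_act_sec hu z := by
    simpa [mul_assoc] using D.slice.phase_sec_mul hu z
  coord_mem hx := D.slice.coord_mem hx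
  act_phase_sec hx := by
    rw [mul_assoc, D.slice.sec_coord_mul hx, mul_inv_cancel_left]
  act_one g := by simp
  map_act z g := by
    rw [QuotientGroup.mk_mul_of_mem]
    exact ⟨z, rfl⟩
  mem_of_map_eq {x y} hx h := by
    obtain ⟨z, hz⟩ := QuotientGroup.eq.1 h
    have : y = x * α z := by rw [hz, mul_inv_cancel_left]
    rw [this, Set.mem_preimage, ← mul_assoc]
    exact D.slice.mul_mem hx z
  coord_eq_of_map_eq {x y} hx h := by
    obtain ⟨z, hz⟩ := QuotientGroup.eq.1 h
    have : y = x * α z := by rw [hz, mul_inv_cancel_left]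
    rw [this, ← mul_assoc]
    exact (D.slice.coord_mul hx z).symm
  contMDiffOn_coord := D.slice.contMDiffOn_coord.comp (contMDiff_leftMul g₀⁻¹).contMDiffOn
    fun _ h => h
  contMDiffOn_phase := D.slice.contMDiffOn_phase.comp (contMDiff_leftMul g₀⁻¹).contMDiffOn
    fun _ h => h
  contMDiffOn_sec := (contMDiff_leftMul g₀).comp_contMDiffOn D.slice.contMDiffOn_sec
  contMDiffOn_act := D.contMDiffOn_sec_mul_exp g₀

/-- The atlas of flow boxes for the projection from `SU(3)` to its quotient by `α`. -/
noncomputable def cosetAtlas : FlowAtlas (𝓡 8) (EuclideanSpace ℝ (Fin 7))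
    (fun _ : Unit => (QuotientGroup.mk : SU3 → SU3 ⧸ α.range)) where
  box _ g := D.cosetBox g
  mem_source _ g := by
    simpa [cosetBox] using D.slice.one_mem
  phase_self _ g := by
    simpa [cosetBox] using D.slice.phase_one
  continuous_map _ := QuotientGroup.continuous_mk
  isOpenMap _ := QuotientGroup.isOpenMap_coe
  exists_map_eq m := ⟨(), QuotientGroup.mk_surjective m⟩
  transition _ _ x _ := ⟨id, Set.univ, isOpen_univ, trivial, contMDiffOn_id, fun _ _ => rfl⟩

theorem isClosed_range (D : TubeData α) : IsClosed (α.range : Set SU3) := by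
  rw [MonoidHom.coe_range]
  exact (isCompact_range D.continuous_hom).isClosed

theorem t2Space_coset (D : TubeData α) : T2Space (SU3 ⧸ α.range) := by
  have := D.isClosed_range
  infer_instance

end TubeData

/-! ### Inversion in the unit sphere of `ℂ²` -/

namespace C2

/-- The inversion in the unit sphere. -/
noncomputable def invert (x : C2) : C2 := (‖x‖ ^ 2)⁻¹ • x

theorem norm_invert (x : C2) : ‖invert x‖ = ‖x‖⁻¹ := by
  rcases eq_or_ne x 0 with rfl | hx
  · simp [invert]
  · have : ‖x‖ ≠ 0 := norm_ne_zero_iff.2 hx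
    rw [invert, norm_smul, norm_inv, norm_pow, norm_norm]
    field_simp

theorem invert_ne_zero {x : C2} (hx : x ≠ 0) : invert x ≠ 0 := by
  rw [← norm_ne_zero_iff, norm_invert]
  exact inv_ne_zero (norm_ne_zero_iff.2 hx)

/-- This holds at the origin too, which `invert` fixes; hence `glue_glue` needs no condition on the
vector. -/
theorem invert_invert (x : C2) : invert (invert x) = x := by
  rcases eq_or_ne x 0 with rfl | hx
  · simp [invert]
  · have : ‖x‖ ≠ 0 := norm_ne_zero_iff.2 hx
    rw [invert, norm_invert, invert, smul_smul]
    have h : (‖x‖⁻¹ ^ 2)⁻¹ * (‖x‖ ^ 2)⁻¹ = 1 := by field_simp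
    rw [h, one_smul]

theorem norm_circle_smul (z : Circle) (x : C2) : ‖(z : ℂ) • x‖ = ‖x‖ := by
  rw [norm_smul, Circle.norm_coe, one_mul]

theorem invert_smul (z : Circle) (x : C2) : invert ((z : ℂ) • x) = (z : ℂ) • invert x := by
  rw [invert, norm_circle_smul, invert, smul_comm]

theorem invert_of_norm_eq_one {x : C2} (hx : ‖x‖ = 1) : invert x = x := by
  simp [invert, hx]

theorem contDiffOn_invert : ContDiffOn ℝ ∞ invert {0}ᶜ := by
  have h1 : ContDiffOn ℝ ∞ (fun x : C2 => ‖x‖ ^ 2) {0}ᶜ := (contDiff_norm_sq ℝ).contDiffOn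
  have h2 : ContDiffOn ℝ ∞ (fun x : C2 => (‖x‖ ^ 2)⁻¹) {0}ᶜ :=
    h1.inv fun x hx => pow_ne_zero 2 (norm_ne_zero_iff.2 hx)
  exact h2.smul contDiffOn_id

end C2

/-! ### Gluing two tubes -/

namespace TubeData

/-- The action of `U(1)` on `ℂ² × SU(3)`. -/
noncomputable def act (α : Circle →* SU3) (z : Circle) (a : C2 × SU3) : C2 × SU3 :=
  ((z : ℂ) • a.1, a.2 * (α z)⁻¹)

section act

variable (α : Circle →* SU3)

theorem act_one (a : C2 × SU3) : act α 1 a = a := by simp [act]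

theorem act_act (z w : Circle) (a : C2 × SU3) : act α z (act α w a) = act α (z * w) a := by
  simp [act, smul_smul, mul_assoc]

theorem act_inv_act (z : Circle) (a : C2 × SU3) : act α z⁻¹ (act α z a) = a := by
  rw [act_act, inv_mul_cancel, act_one]

theorem continuous_act (z : Circle) : Continuous (act α z) := by
  unfold act
  fun_prop

theorem act_fst_ne_zero {z : Circle} {a : C2 × SU3} : (act α z a).1 ≠ 0 ↔ a.1 ≠ 0 := by
  simp [act]

end act

variable {α : Bool → Circle →* SU3} (D : ∀ i, TubeData (α i))

/-- The identification of the complements of the zero sections of the two tubes. -/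
noncomputable def glue (i : Bool) (a : C2 × SU3) : C2 × SU3 :=
  (C2.invert a.1, a.2 * (D i).frame a.1 * ((D !i).frame (C2.invert a.1))⁻¹)

/-- The factor `(α i z)⁻¹` cancels against the equivariance of the first frame, and the inverse of
the second frame puts `(α (!i) z)⁻¹` on the right. So `glue` descends to the quotients by U(1). -/
theorem glue_act (i : Bool) (z : Circle) {a : C2 × SU3} (ha : a.1 ≠ 0) :
    glue D i (act (α i) z a) = act (α !i) z (glue D i a) := by
  refine Prod.ext (C2.invert_smul z a.1) ?_
  simp only [glue, act, C2.invert_smul, (D i).frame_smul z ha,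
    (D !i).frame_smul z (C2.invert_ne_zero ha)]
  group

/-- `glue` inverts the vector and preserves the product of the group element with the frame, a
description symmetric in the two tubes. -/
theorem glue_glue (i : Bool) {a : C2 × SU3} : glue D (!i) (glue D i a) = a := by
  refine Prod.ext (C2.invert_invert a.1) ?_
  simp only [glue, C2.invert_invert, inv_mul_cancel_right]
  cases i <;> exact mul_inv_cancel_right _ _

theorem glue_ne_zero (i : Bool) {a : C2 × SU3} (ha : a.1 ≠ 0) : (glue D i a).1 ≠ 0 :=
  C2.invert_ne_zero ha

theorem isOpen_fst_ne_zero : IsOpen {a : C2 × SU3 | a.1 ≠ 0} :=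
  isOpen_ne_fun continuous_fst continuous_const

theorem contMDiffOn_glue (i : Bool) :
    ContMDiffOn (𝓘(ℝ, C2).prod (𝓡 8)) (𝓘(ℝ, C2).prod (𝓡 8)) ∞ (glue D i) {a | a.1 ≠ 0} := by
  have h1 : ContMDiffOn (𝓘(ℝ, C2).prod (𝓡 8)) 𝓘(ℝ, C2) ∞
      (fun a : C2 × SU3 => C2.invert a.1) {a | a.1 ≠ 0} :=
    C2.contDiffOn_invert.contMDiffOn.comp contMDiff_fst.contMDiffOn fun a ha => ha
  have h2 : ContMDiffOn (𝓘(ℝ, C2).prod (𝓡 8)) (𝓡 8) ∞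
      (fun a : C2 × SU3 => (D i).frame a.1) {a | a.1 ≠ 0} :=
    (D i).contMDiffOn_frame.comp contMDiff_fst.contMDiffOn fun a ha => ha
  have h3 : ContMDiffOn (𝓘(ℝ, C2).prod (𝓡 8)) (𝓡 8) ∞
      (fun a : C2 × SU3 => (D !i).frame (C2.invert a.1)) {a | a.1 ≠ 0} :=
    (D !i).contMDiffOn_frame.comp h1 fun a ha => C2.invert_ne_zero ha
  exact h1.prodMk ((contMDiff_snd.contMDiffOn.mul h2).mul h3.inv)

/-- Two points of the tubes are identified if they lie on the same orbit of `U(1)` up to `glue`. -/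
def gluedSetoid : Setoid (Σ _ : Bool, C2 × SU3) where
  r a b := (b.1 = a.1 ∧ ∃ z, b.2 = act (α a.1) z a.2) ∨
    (b.1 = !a.1) ∧ a.2.1 ≠ 0 ∧ ∃ z, b.2 = act (α !a.1) z (glue D a.1 a.2)
  iseqv := by
    refine ⟨fun a => Or.inl ⟨rfl, 1, (act_one _ _).symm⟩, ?_, ?_⟩
    · rintro ⟨i, a⟩ ⟨j, b⟩ (⟨h, z, hz⟩ | ⟨h, h0, z, hz⟩)
      · obtain rfl : j = i := h
        obtain rfl : b = act (α j) z a := hz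
        exact Or.inl ⟨rfl, z⁻¹, (act_inv_act _ _ _).symm⟩
      · obtain rfl : j = !i := h
        obtain rfl : b = act (α !i) z (glue D i a) := hz
        have h1 : a.1 ≠ 0 := h0
        refine Or.inr ⟨(Bool.not_not i).symm, (act_fst_ne_zero _).2 (glue_ne_zero D i h1), z⁻¹, ?_⟩
        change a = act (α !!i) z⁻¹ (glue D (!i) (act (α !i) z (glue D i a)))
        rw [glue_act D _ _ (glue_ne_zero D i h1), act_inv_act, glue_glue]
    · rintro ⟨i, a⟩ ⟨j, b⟩ ⟨k, c⟩ (⟨h, z, hz⟩ | ⟨h, h0, z, hz⟩)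
      · obtain rfl : j = i := h
        obtain rfl : b = act (α j) z a := hz
        rintro (⟨h', w, hw⟩ | ⟨h', h0', w, hw⟩)
        · obtain rfl : k = j := h'
          obtain rfl : c = act (α k) w (act (α k) z a) := hw
          exact Or.inl ⟨rfl, w * z, act_act _ _ _ _⟩
        · obtain rfl : k = !j := h'
          have h1 : a.1 ≠ 0 := (act_fst_ne_zero (α j)).1 h0'
          obtain rfl : c = act (α !j) w (glue D j (act (α j) z a)) := hw
          refine Or.inr ⟨rfl, h1, w * z, ?_⟩
          change act (α !j) w (glue D j (act (α j) z a)) = act (α !j) (w * z) (glue D j a)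
          rw [glue_act D _ _ h1, act_act]
      · obtain rfl : j = !i := h
        have h1 : a.1 ≠ 0 := h0
        obtain rfl : b = act (α !i) z (glue D i a) := hz
        rintro (⟨h', w, hw⟩ | ⟨h', h0', w, hw⟩)
        · obtain rfl : k = !i := h'
          obtain rfl : c = act (α !i) w (act (α !i) z (glue D i a)) := hw
          exact Or.inr ⟨rfl, h1, w * z, act_act _ _ _ _⟩
        · refine Or.inl ⟨h'.trans (Bool.not_not i), w * z, ?_⟩
          obtain rfl : c = act (α !!i) w (glue D (!i) (act (α !i) z (glue D i a))) := hw
          change act (α !!i) w (glue D (!i) (act (α !i) z (glue D i a))) = act (α i) (w * z) a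
          rw [glue_act D _ _ (glue_ne_zero D i h1), glue_glue, act_act, Bool.not_not]

/-- The space obtained from the two tubes `ℂ² ×_α SU(3)` by identifying the complements of the
zero sections. -/
def Glued : Type := Quotient (gluedSetoid D)

namespace Glued

instance : TopologicalSpace (Glued D) :=
  inferInstanceAs (TopologicalSpace (Quotient (gluedSetoid D)))

/-- The map from `ℂ² × SU(3)` to the glued space that factors through the tube `i`. -/
def mk (i : Bool) (a : C2 × SU3) : Glued D := Quotient.mk (gluedSetoid D) ⟨i, a⟩

variable {D}

theorem mk_eq_mk {i : Bool} {a b : C2 × SU3} :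
    mk D i a = mk D i b ↔ ∃ z, b = act (α i) z a := by
  refine Quotient.eq.trans ⟨?_, fun h => Or.inl ⟨rfl, h⟩⟩
  rintro (⟨-, h⟩ | ⟨h, -⟩)
  · exact h
  · exact absurd h (by cases i <;> simp)

theorem mk_eq_mk_not {i : Bool} {a b : C2 × SU3} :
    mk D i a = mk D (!i) b ↔ a.1 ≠ 0 ∧ ∃ z, b = act (α !i) z (glue D i a) := by
  refine Quotient.eq.trans ⟨?_, fun h => Or.inr ⟨rfl, h⟩⟩
  rintro (⟨h, -⟩ | ⟨-, h⟩)
  · exact absurd h (by cases i <;> simp)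
  · exact h

theorem mk_act (i : Bool) (z : Circle) (a : C2 × SU3) : mk D i (act (α i) z a) = mk D i a :=
  (mk_eq_mk.2 ⟨z, rfl⟩).symm

theorem mk_glue (i : Bool) {a : C2 × SU3} (ha : a.1 ≠ 0) :
    mk D (!i) (glue D i a) = mk D i a :=
  (mk_eq_mk_not.2 ⟨ha, 1, (act_one _ _).symm⟩).symm

theorem exists_mk_eq (m : Glued D) : ∃ i a, mk D i a = m := by
  obtain ⟨⟨i, a⟩, rfl⟩ := Quotient.exists_rep m
  exact ⟨i, a, rfl⟩

theorem continuous_mk (i : Bool) : Continuous (mk D i) :=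
  continuous_quotient_mk'.comp continuous_sigmaMk

/-- The saturation of an open set is a union of U(1)-translates in its own tube and, in the other
tube, of preimages under `glue` followed by translations. -/
theorem isOpenMap_mk (i : Bool) : IsOpenMap (mk D i) := by
  intro U hU
  change IsOpen (Quotient.mk (gluedSetoid D) ⁻¹' _)
  refine isOpen_sigma_iff.2 fun j => ?_
  change IsOpen (mk D j ⁻¹' (mk D i '' U))
  rcases Bool.eq_or_eq_not j i with rfl | rfl
  · have : mk D j ⁻¹' (mk D j '' U) = ⋃ z, act (α j) z ⁻¹' U := by
      ext b
      simp only [Set.mem_preimage, Set.mem_image, Set.mem_iUnion]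
      constructor
      · rintro ⟨a, ha, h⟩
        obtain ⟨z, rfl⟩ := mk_eq_mk.1 h
        exact ⟨z⁻¹, by rwa [act_inv_act]⟩
      · rintro ⟨z, h⟩
        exact ⟨_, h, mk_act _ _ _⟩
    rw [this]
    exact isOpen_iUnion fun z => hU.preimage (continuous_act _ z)
  · have : mk D (!i) ⁻¹' (mk D i '' U) =
        ⋃ z, {b | b.1 ≠ 0} ∩ (act (α i) z ∘ glue D (!i)) ⁻¹' U := by
      ext b
      simp only [Set.mem_preimage, Set.mem_image, Set.mem_iUnion]
      constructor
      · rintro ⟨a, ha, h⟩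
        obtain ⟨h0, z, rfl⟩ := mk_eq_mk_not.1 h
        refine ⟨z⁻¹, (act_fst_ne_zero _).2 (glue_ne_zero D i h0), ?_⟩
        rw [Set.mem_preimage, Function.comp_apply, glue_act D _ _ (glue_ne_zero D i h0),
          glue_glue, Bool.not_not, act_inv_act]
        exact ha
      · rintro ⟨z, h0, h⟩
        refine ⟨_, h, ?_⟩
        have := mk_glue (D := D) (!i) h0
        rw [Bool.not_not] at this
        rw [Function.comp_apply, mk_act, this]
    rw [this]
    refine isOpen_iUnion fun z => ContinuousOn.isOpen_inter_preimage ?_ isOpen_fst_ne_zero hU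
    exact (continuous_act _ z).comp_continuousOn (contMDiffOn_glue D _).continuousOn

/-- `SU(3)` acts by left translation on the second factor. -/
instance : MulAction SU3 (Glued D) where
  smul g := Quotient.map (fun a => ⟨a.1, a.2.1, g * a.2.2⟩) (by
    rintro ⟨i, a⟩ ⟨j, b⟩ (⟨h, z, hz⟩ | ⟨h, h0, z, hz⟩)
    · refine Or.inl ⟨h, z, ?_⟩
      obtain rfl : b = act (α i) z a := hz
      simp [act, mul_assoc]
    · refine Or.inr ⟨h, h0, z, ?_⟩
      obtain rfl : b = act (α !i) z (glue D i a) := hz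
      simp [act, glue, mul_assoc])
  one_smul := by
    rintro ⟨i, a⟩
    exact congrArg (mk D i) (by simp)
  mul_smul := by
    rintro g h ⟨i, a⟩
    exact congrArg (mk D i) (by simp [mul_assoc])

theorem smul_mk (g : SU3) (i : Bool) (a : C2 × SU3) : g • mk D i a = mk D i (a.1, g * a.2) := rfl

end Glued

end TubeData

/-! ### Smooth structure of the glued space -/

namespace TubeData

/-- Linear coordinates on `ℂ² × ℝ⁷`. -/
noncomputable def lin : (C2 × EuclideanSpace ℝ (Fin 7)) ≃L[ℝ] EuclideanSpace ℝ (Fin 11) :=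
  ContinuousLinearEquiv.ofFinrankEq (by
    rw [Module.finrank_prod, finrank_real_of_complex, finrank_euclideanSpace_fin,
      finrank_euclideanSpace_fin, finrank_euclideanSpace_fin])

theorem contDiff_complex_smul : ContDiff ℝ ∞ fun x : ℂ × C2 => x.1 • x.2 :=
  contDiff_fst.smul contDiff_snd

theorem contMDiffOn_complex_smul {E H N : Type*} [NormedAddCommGroup E] [NormedSpace ℝ E]
    [TopologicalSpace H] {I : ModelWithCorners ℝ E H} [TopologicalSpace N] [ChartedSpace H N]
    {c : N → ℂ} {f : N → C2} {s : Set N} (hc : ContMDiffOn I 𝓘(ℝ, ℂ) ∞ c s)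
    (hf : ContMDiffOn I 𝓘(ℝ, C2) ∞ f s) : ContMDiffOn I 𝓘(ℝ, C2) ∞ (fun x => c x • f x) s :=
  contDiff_complex_smul.contMDiff.comp_contMDiffOn (hc.prodMk_space hf)

variable {α : Bool → Circle →* SU3} (D : ∀ i, TubeData (α i))

/-- The flow box around the fibre over the coset of `g₀` of the projection to the tube `i`. -/
noncomputable def tubeBox (i : Bool) (g₀ : SU3) :
    FlowBox (𝓘(ℝ, C2).prod (𝓡 8)) (EuclideanSpace ℝ (Fin 11)) (Glued.mk D i) where
  source := (fun a => g₀⁻¹ * a.2) ⁻¹' (D i).slice.source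
  target := (fun u => (lin.symm u).2) ⁻¹' (D i).slice.target
  -- U(1) multiplies the vector by z and the phase of the group element by z⁻¹, so the phase times
  -- the vector is invariant.
  coord a := lin (((D i).slice.phase (g₀⁻¹ * a.2) : ℂ) • a.1, (D i).slice.coord (g₀⁻¹ * a.2))
  phase a := (D i).slice.phase (g₀⁻¹ * a.2)
  sec u := ((lin.symm u).1, g₀ * (D i).slice.sec (lin.symm u).2)
  -- The inverse is needed because a flow box multiplies the phase by z, that is, moves the group
  -- element by right multiplication with `α i z`.
  act z := act (α i) z⁻¹
  isOpen_source := (D i).slice.isOpen_source.preimage (continuous_const.mul continuous_snd)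
  isOpen_target := (D i).slice.isOpen_target.preimage (continuous_snd.comp lin.symm.continuous)
  act_sec_mem hu z := by
    simpa [act, mul_assoc] using (D i).slice.sec_mul_mem hu z
  coord_act_sec {u} hu z := by
    have h1 := (D i).slice.coord_sec_mul hu z
    have h2 := (D i).slice.phase_sec_mul hu z
    simp [act, mul_assoc, h1, h2, smul_smul]
  phase_act_sec hu z := by
    simpa [act, mul_assoc] using (D i).slice.phase_sec_mul hu z
  coord_mem {x} hx := by
    simpa using (D i).slice.coord_mem hx
  act_phase_sec {x} hx := by
    have h := (D i).slice.sec_coord_mul hx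
    refine Prod.ext ?_ ?_
    · simp [act, smul_smul]
    · simp [act, mul_assoc, h]
  act_one a := by simp [act]
  map_act z a := Glued.mk_act i z⁻¹ a
  mem_of_map_eq {x y} hx h := by
    obtain ⟨z, rfl⟩ := Glued.mk_eq_mk.1 h
    rw [Set.mem_preimage, act, ← map_inv, ← mul_assoc]
    exact (D i).slice.mul_mem hx z⁻¹
  coord_eq_of_map_eq {x y} hx h := by
    obtain ⟨z, rfl⟩ := Glued.mk_eq_mk.1 h
    have h1 := (D i).slice.coord_mul hx z⁻¹
    have h2 := (D i).slice.phase_mul hx z⁻¹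
    rw [act, ← map_inv, ← mul_assoc, h1, h2, smul_smul, ← Circle.coe_mul, inv_mul_cancel_right]
  contMDiffOn_coord := by
    have h0 : ContMDiff (𝓘(ℝ, C2).prod (𝓡 8)) (𝓡 8) ∞ (fun a : C2 × SU3 => g₀⁻¹ * a.2) :=
      (contMDiff_leftMul g₀⁻¹).comp contMDiff_snd
    have h1 := (D i).slice.contMDiffOn_phase.comp h0.contMDiffOn fun _ h => h
    have h2 := (D i).slice.contMDiffOn_coord.comp h0.contMDiffOn fun _ h => h
    exact lin.contDiff.contMDiff.comp_contMDiffOn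
      ((contMDiffOn_complex_smul h1 contMDiff_fst.contMDiffOn).prodMk_space h2)
  contMDiffOn_phase := by
    have h0 : ContMDiff (𝓘(ℝ, C2).prod (𝓡 8)) (𝓡 8) ∞ (fun a : C2 × SU3 => g₀⁻¹ * a.2) :=
      (contMDiff_leftMul g₀⁻¹).comp contMDiff_snd
    exact (D i).slice.contMDiffOn_phase.comp h0.contMDiffOn fun _ h => h
  contMDiffOn_sec := by
    have h1 : ContMDiff 𝓘(ℝ, EuclideanSpace ℝ (Fin 11)) 𝓘(ℝ, C2) ∞ fun u => (lin.symm u).1 :=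
      (contDiff_fst.comp lin.symm.contDiff).contMDiff
    have h2 : ContMDiff 𝓘(ℝ, EuclideanSpace ℝ (Fin 11)) (𝓡 7) ∞ fun u => (lin.symm u).2 :=
      (contDiff_snd.comp lin.symm.contDiff).contMDiff
    exact h1.contMDiffOn.prodMk ((contMDiff_leftMul g₀).comp_contMDiffOn
      ((D i).slice.contMDiffOn_sec.comp h2.contMDiffOn fun _ h => h))
  contMDiffOn_act := by
    have h1 : ContMDiff 𝓘(ℝ, EuclideanSpace ℝ (Fin 11) × ℝ) 𝓘(ℝ, C2) ∞
        fun u : EuclideanSpace ℝ (Fin 11) × ℝ => (lin.symm u.1).1 :=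
      (contDiff_fst.comp (lin.symm.contDiff.comp contDiff_fst)).contMDiff
    have h2 : ContMDiff 𝓘(ℝ, EuclideanSpace ℝ (Fin 11) × ℝ)
        𝓘(ℝ, EuclideanSpace ℝ (Fin 7) × ℝ) ∞
        fun u : EuclideanSpace ℝ (Fin 11) × ℝ => ((lin.symm u.1).2, u.2) :=
      ((contDiff_snd.comp (lin.symm.contDiff.comp contDiff_fst)).prodMk contDiff_snd).contMDiff
    have h3 : ContMDiff 𝓘(ℝ, EuclideanSpace ℝ (Fin 11) × ℝ) 𝓘(ℝ, ℂ) ∞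
        fun u : EuclideanSpace ℝ (Fin 11) × ℝ => ((Circle.exp (-u.2) : Circle) : ℂ) :=
      (Circle.contDiff_coe_exp.comp contDiff_snd.neg).contMDiff
    have h4 := ((D i).contMDiffOn_sec_mul_exp g₀).comp
      (s := {u : EuclideanSpace ℝ (Fin 11) × ℝ | (lin.symm u.1).2 ∈ (D i).slice.target})
      h2.contMDiffOn fun _ h => h
    refine ((contMDiffOn_complex_smul h3.contMDiffOn h1.contMDiffOn).prodMk h4).congr
      fun u _ => ?_
    simp [act, Circle.exp_neg]

/-- The atlas of flow boxes of the glued space. -/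
noncomputable def gluedAtlas :
    FlowAtlas (𝓘(ℝ, C2).prod (𝓡 8)) (EuclideanSpace ℝ (Fin 11)) (Glued.mk D) where
  box i a := tubeBox D i a.2
  mem_source i a := by
    simpa [tubeBox] using (D i).slice.one_mem
  phase_self i a := by
    simpa [tubeBox] using (D i).slice.phase_one
  continuous_map := Glued.continuous_mk
  isOpenMap := Glued.isOpenMap_mk
  exists_map_eq := Glued.exists_mk_eq
  transition i j a ha := by
    rcases Bool.eq_or_eq_not i j with rfl | rfl
    · exact ⟨id, Set.univ, isOpen_univ, trivial, contMDiffOn_id, fun _ _ => rfl⟩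
    · obtain ⟨b, hb⟩ := ha
      exact ⟨glue D j, {a | a.1 ≠ 0}, isOpen_fst_ne_zero, (Glued.mk_eq_mk_not.1 hb.symm).1,
        contMDiffOn_glue D j, fun y hy => Glued.mk_glue j hy⟩

namespace Glued

noncomputable instance : ChartedSpace (EuclideanSpace ℝ (Fin 11)) (Glued D) :=
  (gluedAtlas D).chartedSpace

instance : IsManifold (𝓡 11) ∞ (Glued D) := (gluedAtlas D).isManifold

variable {D}

theorem contMDiff_mk (i : Bool) : ContMDiff (𝓘(ℝ, C2).prod (𝓡 8)) (𝓡 11) ∞ (mk D i) :=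
  (gluedAtlas D).contMDiff_map i

theorem exists_section (m : Glued D) : ∃ (i : Bool) (s : Glued D → C2 × SU3) (U : Set (Glued D)),
    IsOpen U ∧ m ∈ U ∧ ContMDiffOn (𝓡 11) (𝓘(ℝ, C2).prod (𝓡 8)) ∞ s U ∧
      ∀ m' ∈ U, mk D i (s m') = m' :=
  (gluedAtlas D).exists_section m

theorem isSubmersion_mk (i : Bool) :
    Manifold.IsSubmersion (𝓘(ℝ, C2).prod (𝓡 8)) (𝓡 11) ∞ (mk D i) := by
  refine (gluedAtlas D).isSubmersion (ContinuousLinearEquiv.ofFinrankEq ?_) i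
  rw [Module.finrank_prod, finrank_real_of_complex, Module.finrank_prod,
    finrank_euclideanSpace_fin, finrank_euclideanSpace_fin, finrank_euclideanSpace_fin,
    Module.finrank_self]

/-- Along a local section the action lifts to left translation on ℂ² × SU(3), which is smooth
because SU(3) is a Lie group. -/
instance : ContMDiffSMul (𝓡 8) (𝓡 11) ∞ SU3 (Glued D) where
  contMDiff_smul := by
    rintro ⟨g, m⟩
    obtain ⟨i, s, U, hU, hm, hs, hsU⟩ := exists_section m
    have hO : IsOpen {p : SU3 × Glued D | p.2 ∈ U} := hU.preimage continuous_snd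
    have h1 : ContMDiffOn ((𝓡 8).prod (𝓡 11)) (𝓘(ℝ, C2).prod (𝓡 8)) ∞
        (fun p : SU3 × Glued D => s p.2) {p | p.2 ∈ U} :=
      hs.comp contMDiff_snd.contMDiffOn fun p hp => hp
    have h2 : ContMDiffOn ((𝓡 8).prod (𝓡 11)) (𝓘(ℝ, C2).prod (𝓡 8)) ∞
        (fun p : SU3 × Glued D => ((s p.2).1, p.1 * (s p.2).2)) {p | p.2 ∈ U} :=
      (contMDiff_fst.comp_contMDiffOn h1).prodMk
        (contMDiff_fst.contMDiffOn.mul (contMDiff_snd.comp_contMDiffOn h1))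
    refine (((contMDiff_mk i).comp_contMDiffOn h2).contMDiffAt
      (hO.mem_nhds hm)).congr_of_eventuallyEq ?_
    filter_upwards [hO.mem_nhds hm] with p hp
    rw [Function.comp_apply, ← smul_mk p.1 i (s p.2), hsU p.2 hp]

/-! #### Topology of the glued space -/

/-- Inversion takes a vector of norm greater than 1 in one tube into the unit disc of the other.
Compactness follows, as each closed disc bundle is an image of a ball times SU(3). -/
theorem mk_disc_union : (⋃ i, mk D i '' {a | ‖a.1‖ ≤ 1}) = Set.univ := by
  refine Set.eq_univ_of_forall fun m => ?_
  obtain ⟨i, a, rfl⟩ := exists_mk_eq m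
  rcases le_or_gt ‖a.1‖ 1 with h | h
  · exact Set.mem_iUnion.2 ⟨i, a, h, rfl⟩
  · have h0 : a.1 ≠ 0 := norm_pos_iff.1 (zero_lt_one.trans h)
    refine Set.mem_iUnion.2 ⟨!i, glue D i a, ?_, mk_glue i h0⟩
    change ‖C2.invert a.1‖ ≤ 1
    rw [C2.norm_invert]
    exact inv_le_one_of_one_le₀ h.le

instance : CompactSpace (Glued D) := by
  refine ⟨?_⟩
  rw [← mk_disc_union]
  refine isCompact_iUnion fun i => IsCompact.image ?_ (continuous_mk i)
  have : {a : C2 × SU3 | ‖a.1‖ ≤ 1} = Metric.closedBall 0 1 ×ˢ Set.univ := by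
    ext a
    simp
  rw [this]
  exact (isCompact_closedBall _ _).prod isCompact_univ

theorem exists_fst_ne_zero : ∃ x : C2, x ≠ 0 := exists_ne 0

instance : ConnectedSpace (Glued D) := by
  obtain ⟨x, hx⟩ := exists_fst_ne_zero
  have h (i : Bool) : IsConnected (Set.range (mk D i)) := isConnected_range (continuous_mk i)
  have hu : Set.range (mk D true) ∪ Set.range (mk D false) = Set.univ := by
    refine Set.eq_univ_of_forall fun m => ?_
    obtain ⟨i, a, rfl⟩ := exists_mk_eq m
    cases i
    · exact Or.inr ⟨a, rfl⟩
    · exact Or.inl ⟨a, rfl⟩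
  have hi : (Set.range (mk D true) ∩ Set.range (mk D false)).Nonempty :=
    ⟨mk D true (x, 1), ⟨_, rfl⟩, ⟨_, mk_glue (D := D) true (a := (x, 1)) hx⟩⟩
  have := IsConnected.union hi (h true) (h false)
  rw [hu] at this
  exact connectedSpace_iff_univ.2 this

end Glued

end TubeData

namespace TubeData

variable {α : Bool → Circle →* SU3} {D : ∀ i, TubeData (α i)}

namespace Glued

theorem mem_tubeBox_source {i : Bool} {a : C2 × SU3} {g₀ : SU3} (z : Circle)
    (h : a.2 = g₀ * α i z) : a ∈ (tubeBox D i g₀).source := by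
  change g₀⁻¹ * a.2 ∈ (D i).slice.source
  rw [h, inv_mul_cancel_left]
  simpa using (D i).slice.mul_mem (D i).slice.one_mem z

/-- If the two points lie over the same coset, one chart contains both. Otherwise their cosets are
separated in the Hausdorff coset space, and preimages of the separating sets give disjoint open
sets. -/
theorem separated_of_tube {i : Bool} {a b : C2 × SU3} (h : mk D i a ≠ mk D i b) :
    SeparatedNhds {mk D i a} {mk D i b} := by
  by_cases hc : (a.2 : SU3 ⧸ (α i).range) = b.2
  · obtain ⟨z, hz⟩ := QuotientGroup.eq.1 hc
    have ha : mk D i a ∈ ((gluedAtlas D).chart i a).source := (gluedAtlas D).mem_chart_source i a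
    have hb : mk D i b ∈ ((gluedAtlas D).chart i a).source :=
      ⟨b, mem_tubeBox_source z (by rw [hz, mul_inv_cancel_left]), rfl⟩
    obtain ⟨u, v, hu, hv, hau, hbv, huv⟩ := t2_separation
      (((gluedAtlas D).chart i a).injOn.ne ha hb h)
    refine ⟨_, _, ((gluedAtlas D).chart i a).isOpen_inter_preimage hu,
      ((gluedAtlas D).chart i a).isOpen_inter_preimage hv, ?_, ?_, ?_⟩
    · exact Set.singleton_subset_iff.2 ⟨ha, hau⟩
    · exact Set.singleton_subset_iff.2 ⟨hb, hbv⟩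
    · exact (huv.preimage _).mono Set.inter_subset_right Set.inter_subset_right
  · have := (D i).t2Space_coset
    obtain ⟨u, v, hu, hv, hau, hbv, huv⟩ := t2_separation hc
    have hq : Continuous fun c : C2 × SU3 => (c.2 : SU3 ⧸ (α i).range) :=
      QuotientGroup.continuous_mk.comp continuous_snd
    refine ⟨_, _, isOpenMap_mk i _ (hu.preimage hq), isOpenMap_mk i _ (hv.preimage hq), ?_, ?_, ?_⟩
    · exact Set.singleton_subset_iff.2 ⟨a, hau, rfl⟩
    · exact Set.singleton_subset_iff.2 ⟨b, hbv, rfl⟩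
    · rw [Set.disjoint_left]
      rintro _ ⟨c, hc, rfl⟩ ⟨d, hd, hdc⟩
      obtain ⟨z, rfl⟩ := mk_eq_mk.1 hdc
      refine Set.disjoint_left.1 huv hc ?_
      have : ((act (α i) z d).2 : SU3 ⧸ (α i).range) = d.2 :=
        QuotientGroup.mk_mul_of_mem _ (inv_mem ⟨z, rfl⟩)
      change ((act (α i) z d).2 : SU3 ⧸ (α i).range) ∈ v
      rw [this]
      exact hd

/-- The open unit disc bundles of the two tubes are disjoint, since gluing inverts the norm. -/
theorem separated_of_ball {i : Bool} {a b : C2 × SU3} (ha : ‖a.1‖ < 1) (hb : ‖b.1‖ < 1) :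
    SeparatedNhds {mk D i a} {mk D (!i) b} := by
  have ho : IsOpen {c : C2 × SU3 | ‖c.1‖ < 1} :=
    isOpen_lt (continuous_norm.comp continuous_fst) continuous_const
  refine ⟨_, _, isOpenMap_mk i _ ho, isOpenMap_mk (!i) _ ho,
    Set.singleton_subset_iff.2 ⟨a, ha, rfl⟩, Set.singleton_subset_iff.2 ⟨b, hb, rfl⟩, ?_⟩
  rw [Set.disjoint_left]
  rintro _ ⟨c, hc, rfl⟩ ⟨d, hd, hdc⟩
  obtain ⟨h0, z, rfl⟩ := mk_eq_mk_not.1 hdc.symm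
  have hd' : ‖(z : ℂ) • C2.invert c.1‖ < 1 := hd
  rw [C2.norm_circle_smul, C2.norm_invert] at hd'
  exact lt_asymm hd' ((one_lt_inv₀ (norm_pos_iff.2 h0)).2 hc)

/-- A point off the zero sections lies in both tubes, so two points share a tube unless they lie on
different zero sections. -/
instance : T2Space (Glued D) := by
  rw [t2Space_iff]
  intro m m' hne
  suffices h : SeparatedNhds {m} {m'} by
    obtain ⟨u, v, hu, hv, hm, hm', huv⟩ := h
    exact ⟨u, v, hu, hv, hm rfl, hm' rfl, huv⟩
  obtain ⟨i, a, rfl⟩ := exists_mk_eq m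
  obtain ⟨j, b, rfl⟩ := exists_mk_eq m'
  rcases Bool.eq_or_eq_not j i with rfl | rfl
  · exact separated_of_tube hne
  · by_cases ha : a.1 = 0
    · by_cases hb : b.1 = 0
      · exact separated_of_ball (by simp [ha]) (by simp [hb])
      · have h := mk_glue (D := D) (!i) hb
        rw [Bool.not_not] at h
        rw [← h] at hne ⊢
        exact separated_of_tube hne
    · rw [← mk_glue i ha] at hne ⊢
      exact separated_of_tube hne

/-! #### The equivariant map to `SU(3)` off the zero sections -/

theorem fst_ne_zero_of_mk_eq {i j : Bool} {a b : C2 × SU3} (h : mk D i a = mk D j b)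
    (ha : a.1 ≠ 0) : b.1 ≠ 0 := by
  rcases Bool.eq_or_eq_not j i with rfl | rfl
  · obtain ⟨z, rfl⟩ := mk_eq_mk.1 h
    exact (act_fst_ne_zero _).2 ha
  · obtain ⟨-, z, rfl⟩ := mk_eq_mk_not.1 h
    exact (act_fst_ne_zero _).2 (glue_ne_zero D i ha)

/-- The factor `(α i z)⁻¹` on the right of the group element cancels the `α i z` on the left of the
frame. With the definition of `glue`, this makes `toSU3` well defined. -/
theorem mul_frame_act (i : Bool) (z : Circle) {a : C2 × SU3} (ha : a.1 ≠ 0) :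
    (act (α i) z a).2 * (D i).frame (act (α i) z a).1 = a.2 * (D i).frame a.1 := by
  simp only [act, (D i).frame_smul z ha]
  group

theorem mul_frame_eq_of_mk_eq {i j : Bool} {a b : C2 × SU3} (h : mk D i a = mk D j b)
    (ha : a.1 ≠ 0) : a.2 * (D i).frame a.1 = b.2 * (D j).frame b.1 := by
  rcases Bool.eq_or_eq_not j i with rfl | rfl
  · obtain ⟨z, rfl⟩ := mk_eq_mk.1 h
    exact (mul_frame_act j z ha).symm
  · obtain ⟨-, z, rfl⟩ := mk_eq_mk_not.1 h
    rw [mul_frame_act _ z (glue_ne_zero D i ha)]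
    simp [glue]

open Classical in
/-- The equivariant map to `SU(3)` on the complement of the zero sections. -/
noncomputable def toSU3 (m : Glued D) : SU3 :=
  if h : ∃ (i : Bool) (a : C2 × SU3), a.1 ≠ 0 ∧ mk D i a = m then
    h.choose_spec.choose.2 * (D h.choose).frame h.choose_spec.choose.1 else 1

theorem toSU3_mk {i : Bool} {a : C2 × SU3} (ha : a.1 ≠ 0) :
    toSU3 (mk D i a) = a.2 * (D i).frame a.1 := by
  have h : ∃ (j : Bool) (b : C2 × SU3), b.1 ≠ 0 ∧ mk D j b = mk D i a := ⟨i, a, ha, rfl⟩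
  rw [toSU3, dif_pos h]
  exact mul_frame_eq_of_mk_eq h.choose_spec.choose_spec.2 h.choose_spec.choose_spec.1

theorem toSU3_smul_mk (g : SU3) {i : Bool} {a : C2 × SU3} (ha : a.1 ≠ 0) :
    toSU3 (g • mk D i a) = g * toSU3 (mk D i a) := by
  rw [smul_mk, toSU3_mk (a := (a.1, g * a.2)) ha, toSU3_mk ha, mul_assoc]

theorem contMDiffAt_toSU3 {i : Bool} {a : C2 × SU3} (ha : a.1 ≠ 0) :
    ContMDiffAt (𝓡 11) (𝓡 8) ∞ (toSU3 (D := D)) (mk D i a) := by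
  obtain ⟨j, s, U, hU, hm, hs, hsU⟩ := exists_section (mk D i a)
  have hs1 : ContMDiffOn (𝓡 11) 𝓘(ℝ, C2) ∞ (fun m => (s m).1) U :=
    contMDiff_fst.comp_contMDiffOn hs
  have hs2 : ContMDiffOn (𝓡 11) (𝓡 8) ∞ (fun m => (s m).2) U :=
    contMDiff_snd.comp_contMDiffOn hs
  have hO : IsOpen (U ∩ (fun m => (s m).1) ⁻¹' {0}ᶜ) :=
    hs1.continuousOn.isOpen_inter_preimage hU isOpen_compl_singleton
  have hmO : mk D i a ∈ U ∩ (fun m => (s m).1) ⁻¹' {0}ᶜ :=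
    ⟨hm, fst_ne_zero_of_mk_eq (hsU _ hm).symm ha⟩
  have h1 : ContMDiffOn (𝓡 11) (𝓡 8) ∞ (fun m => (s m).2 * (D j).frame (s m).1)
      (U ∩ (fun m => (s m).1) ⁻¹' {0}ᶜ) :=
    (hs2.mono Set.inter_subset_left).mul ((D j).contMDiffOn_frame.comp
      (hs1.mono Set.inter_subset_left) fun m hm => hm.2)
  refine (h1.contMDiffAt (hO.mem_nhds hmO)).congr_of_eventuallyEq ?_
  filter_upwards [hO.mem_nhds hmO] with m hm
  conv_lhs => rw [← hsU m hm.1, toSU3_mk hm.2]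

/-- `toSU3` is equivariant at this point, and left translation on SU(3) is free. -/
theorem stabilizer_mk {i : Bool} {a : C2 × SU3} (ha : a.1 ≠ 0) :
    MulAction.stabilizer SU3 (mk D i a) = ⊥ := by
  refine (Subgroup.eq_bot_iff_forall _).2 fun g hg => ?_
  have h := toSU3_smul_mk g (i := i) (D := D) ha
  rw [MulAction.mem_stabilizer_iff.1 hg] at h
  exact mul_eq_right.1 h.symm

/-! #### Dimensions of orbits -/

theorem contMDiff_orbitMap (m : Glued D) : ContMDiff (𝓡 8) (𝓡 11) ∞ fun g : SU3 => g • m := by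
  obtain ⟨i, a, rfl⟩ := exists_mk_eq m
  exact (contMDiff_mk i).comp (contMDiff_const.prodMk (contMDiff_mul_right (a := a.2)))

theorem orbitDim_le (m : Glued D) : orbitDim (𝓡 8) (𝓡 11) SU3 m ≤ 8 := by
  have : FiniteDimensional ℝ (TangentSpace (𝓡 8) (1 : SU3)) :=
    inferInstanceAs (FiniteDimensional ℝ (EuclideanSpace ℝ (Fin 8)))
  have h1 : Module.finrank ℝ (TangentSpace (𝓡 8) (1 : SU3)) = 8 :=
    finrank_euclideanSpace_fin (𝕜 := ℝ) (n := 8)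
  exact (LinearMap.finrank_range_le _).trans h1.le

theorem orbitCodim_add_orbitDim (m : Glued D) :
    orbitCodim (𝓡 8) (𝓡 11) SU3 m + orbitDim (𝓡 8) (𝓡 11) SU3 m = 11 := by
  have : FiniteDimensional ℝ (TangentSpace (𝓡 11) ((1 : SU3) • m)) :=
    inferInstanceAs (FiniteDimensional ℝ (EuclideanSpace ℝ (Fin 11)))
  have h1 : Module.finrank ℝ (TangentSpace (𝓡 11) ((1 : SU3) • m)) = 11 :=
    finrank_euclideanSpace_fin (𝕜 := ℝ) (n := 11)
  exact (Submodule.finrank_quotient_add_finrank _).trans h1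

/-- The equivariant map `toSU3`, translated by a constant, is a left inverse of the orbit map, so
the differential of the orbit map at `1` is injective. -/
theorem orbitDim_mk_of_ne_zero {i : Bool} {a : C2 × SU3} (ha : a.1 ≠ 0) :
    orbitDim (𝓡 8) (𝓡 11) SU3 (mk D i a) = 8 := by
  let h : Glued D → SU3 := fun m => toSU3 m * (toSU3 (mk D i a))⁻¹
  have hh : ContMDiffAt (𝓡 11) (𝓡 8) ∞ h ((1 : SU3) • mk D i a) := by
    rw [one_smul]
    exact (contMDiffAt_toSU3 ha).mul contMDiffAt_const
  have hcomp : (h ∘ fun g : SU3 => g • mk D i a) = id := by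
    funext g
    change toSU3 (g • mk D i a) * (toSU3 (mk D i a))⁻¹ = g
    rw [toSU3_smul_mk g ha, mul_inv_cancel_right]
  have hd := mfderiv_comp (I := 𝓡 8) (I' := 𝓡 11) (I'' := 𝓡 8) (1 : SU3)
    (f := fun g : SU3 => g • mk D i a) (g := h)
    (hh.mdifferentiableAt (by simp)) ((contMDiff_orbitMap _ 1).mdifferentiableAt (by simp))
  rw [hcomp, mfderiv_id] at hd
  have hinj : Function.Injective (mfderiv (𝓡 8) (𝓡 11) (fun g : SU3 => g • mk D i a) 1) := by
    intro v w hvw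
    have hv := DFunLike.congr_fun hd v
    have hw := DFunLike.congr_fun hd w
    have : mfderiv (𝓡 11) (𝓡 8) h ((1 : SU3) • mk D i a)
        (mfderiv (𝓡 8) (𝓡 11) (fun g : SU3 => g • mk D i a) 1 v) =
        mfderiv (𝓡 11) (𝓡 8) h ((1 : SU3) • mk D i a)
        (mfderiv (𝓡 8) (𝓡 11) (fun g : SU3 => g • mk D i a) 1 w) := by rw [hvw]
    exact hv.trans (this.trans hw.symm)
  have h1 : Module.finrank ℝ (TangentSpace (𝓡 8) (1 : SU3)) = 8 :=
    finrank_euclideanSpace_fin (𝕜 := ℝ) (n := 8)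
  exact (LinearMap.finrank_range_of_inj hinj).trans h1

/-- With zero vector the point depends only on the coset of the group element, so near `1` the orbit
map factors through the slice coordinate in ℝ⁷ and its differential has rank at most 7. -/
theorem orbitDim_mk_zero (i : Bool) (g₀ : SU3) :
    orbitDim (𝓡 8) (𝓡 11) SU3 (mk D i (0, g₀)) < 8 := by
  let κ : SU3 → EuclideanSpace ℝ (Fin 7) := fun g => (D i).slice.coord (g₀⁻¹ * (g * g₀))
  let ψ : EuclideanSpace ℝ (Fin 7) → Glued D := fun v => mk D i (0, g₀ * (D i).slice.sec v)
  have hc : ContMDiff (𝓡 8) (𝓡 8) ∞ fun g : SU3 => g₀⁻¹ * (g * g₀) :=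
    (contMDiff_leftMul g₀⁻¹).comp contMDiff_mul_right
  let O : Set SU3 := (fun g : SU3 => g₀⁻¹ * (g * g₀)) ⁻¹' (D i).slice.source
  have hO : IsOpen O := (D i).slice.isOpen_source.preimage hc.continuous
  have h1 : (1 : SU3) ∈ O := by
    simpa [O] using (D i).slice.one_mem
  have hκ : ContMDiffAt (𝓡 8) (𝓡 7) ∞ κ 1 :=
    ((D i).slice.contMDiffOn_coord.comp hc.contMDiffOn fun _ h => h).contMDiffAt (hO.mem_nhds h1)
  have hψ : ContMDiffAt (𝓡 7) (𝓡 11) ∞ ψ (κ 1) :=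
    ((contMDiff_mk i).comp_contMDiffOn (contMDiffOn_const.prodMk
      ((contMDiff_leftMul g₀).comp_contMDiffOn (D i).slice.contMDiffOn_sec))).contMDiffAt
      ((D i).slice.isOpen_target.mem_nhds ((D i).slice.coord_mem h1))
  have heq : (fun g : SU3 => g • mk D i (0, g₀)) =ᶠ[𝓝 1] ψ ∘ κ := by
    filter_upwards [hO.mem_nhds h1] with g hg
    have h2 := (D i).slice.sec_coord_mul hg
    refine mk_eq_mk.2 ⟨(D i).slice.phase (g₀⁻¹ * (g * g₀)), Prod.ext ?_ ?_⟩
    · simp [act]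
    · change g₀ * (D i).slice.sec (κ g) = g * g₀ * (α i _)⁻¹
      rw [eq_mul_inv_iff_mul_eq, mul_assoc, h2, mul_inv_cancel_left]
  have hd := ((hψ.mdifferentiableAt (by simp)).hasMFDerivAt.comp 1
    (hκ.mdifferentiableAt (by simp)).hasMFDerivAt).congr_of_eventuallyEq heq
  -- The differentials are restated between Euclidean spaces, to which the tangent spaces unfold, so
  -- that the rank bounds apply.
  let A : EuclideanSpace ℝ (Fin 7) →L[ℝ] EuclideanSpace ℝ (Fin 11) := mfderiv (𝓡 7) (𝓡 11) ψ (κ 1)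
  let B : EuclideanSpace ℝ (Fin 8) →L[ℝ] EuclideanSpace ℝ (Fin 7) := mfderiv (𝓡 8) (𝓡 7) κ 1
  have hAB : mfderiv (𝓡 8) (𝓡 11) (fun g : SU3 => g • mk D i (0, g₀)) 1 = A.comp B := hd.mfderiv
  have hle : Module.finrank ℝ (LinearMap.range (A.comp B).toLinearMap) ≤ 7 :=
    (Submodule.finrank_mono (LinearMap.range_comp_le_range B.toLinearMap A.toLinearMap)).trans
      ((LinearMap.finrank_range_le A.toLinearMap).trans finrank_euclideanSpace_fin.le)
  rw [orbitDim, orbitTangent, hAB]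
  exact Nat.lt_succ_of_le hle

end Glued

end TubeData

namespace TubeData

variable {α : Bool → Circle →* SU3} {D : ∀ i, TubeData (α i)}

namespace Glued

/-! #### The zero sections -/

variable (D) in
/-- The zero section of the tube `i`. -/
def zeroOrbit (i : Bool) : Set (Glued D) := mk D i '' {a | a.1 = 0}

theorem mk_mem_zeroOrbit {i : Bool} {a : C2 × SU3} (ha : a.1 = 0) : mk D i a ∈ zeroOrbit D i :=
  ⟨a, ha, rfl⟩

theorem orbit_mk_of_eq_zero {i : Bool} {a : C2 × SU3} (ha : a.1 = 0) :
    MulAction.orbit SU3 (mk D i a) = zeroOrbit D i := by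
  ext m
  constructor
  · rintro ⟨g, rfl⟩
    exact ⟨(a.1, g * a.2), ha, rfl⟩
  · rintro ⟨b, hb, rfl⟩
    refine ⟨b.2 * a.2⁻¹, ?_⟩
    change mk D i (a.1, b.2 * a.2⁻¹ * a.2) = mk D i b
    rw [inv_mul_cancel_right, ha, ← hb]

theorem zeroOrbit_ne : zeroOrbit D true ≠ zeroOrbit D false := by
  intro h
  have h1 : mk D true (0, 1) ∈ zeroOrbit D false := h ▸ mk_mem_zeroOrbit rfl
  obtain ⟨b, -, h2⟩ := h1
  exact (mk_eq_mk_not (i := true).1 h2.symm).1 rfl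

theorem isPrincipalOrbit_mk {i : Bool} {a : C2 × SU3} (ha : a.1 ≠ 0) :
    IsPrincipalOrbit SU3 (MulAction.orbit SU3 (mk D i a)) := by
  refine ⟨mk D i a, rfl, fun m' => ⟨1, ?_⟩⟩
  rw [one_smul, stabilizer_mk ha]
  exact bot_le

theorem orbitDim_lt_of_eq_zero {i : Bool} {a : C2 × SU3} (ha : a.1 = 0) :
    orbitDim (𝓡 8) (𝓡 11) SU3 (mk D i a) < 8 := by
  obtain ⟨x, g⟩ := a
  obtain rfl : x = 0 := ha
  exact orbitDim_mk_zero i g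

/-- The maximal orbit dimension is 8, attained exactly off the zero sections, and each zero section
is a single orbit. -/
theorem isSingularOrbit_iff (O : Set (Glued D)) :
    IsSingularOrbit (𝓡 8) (𝓡 11) SU3 O ↔ O = zeroOrbit D true ∨ O = zeroOrbit D false := by
  constructor
  · rintro ⟨m, rfl, m', hm'⟩
    obtain ⟨i, a, rfl⟩ := exists_mk_eq m
    by_cases ha : a.1 = 0
    · rw [orbit_mk_of_eq_zero ha]
      cases i
      · exact Or.inr rfl
      · exact Or.inl rfl
    · rw [orbitDim_mk_of_ne_zero ha] at hm'
      exact absurd (orbitDim_le m') hm'.not_ge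
  · have h (i : Bool) : IsSingularOrbit (𝓡 8) (𝓡 11) SU3 (zeroOrbit D i) := by
      obtain ⟨x, hx⟩ := exists_fst_ne_zero
      refine ⟨mk D i (0, 1), (orbit_mk_of_eq_zero rfl).symm, mk D i (x, 1), ?_⟩
      rw [orbitDim_mk_of_ne_zero (a := (x, 1)) hx]
      exact orbitDim_lt_of_eq_zero rfl
    rintro (rfl | rfl)
    · exact h true
    · exact h false

theorem hasCohomogeneity : HasCohomogeneity (𝓡 8) (𝓡 11) SU3 (Glued D) 3 := by
  constructor
  · obtain ⟨x, hx⟩ := exists_fst_ne_zero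
    refine ⟨mk D true (x, 1), ?_⟩
    have h1 := orbitCodim_add_orbitDim (mk D true (x, 1))
    rw [orbitDim_mk_of_ne_zero (a := (x, 1)) hx] at h1
    exact Nat.add_right_cancel (m := 8) h1
  · rintro _ ⟨m, rfl⟩
    have h1 := orbitCodim_add_orbitDim m
    have h2 := orbitDim_le m
    change 3 ≤ orbitCodim (𝓡 8) (𝓡 11) SU3 m
    omega

/-! #### The zero sections as embedded coset spaces -/

variable (D) in
/-- The zero section as a map from the coset space. -/
noncomputable def zeroMap (i : Bool) : SU3 ⧸ (α i).range → Glued D :=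
  Quotient.lift (fun g => mk D i (0, g)) fun g h hgh => by
    obtain ⟨z, hz⟩ := QuotientGroup.leftRel_apply.1 hgh
    refine mk_eq_mk.2 ⟨z⁻¹, Prod.ext (by simp [act]) ?_⟩
    simp [act, hz]

theorem zeroMap_smul (i : Bool) (g : SU3) (w : SU3 ⧸ (α i).range) :
    zeroMap D i (g • w) = g • zeroMap D i w := by
  obtain ⟨h, rfl⟩ := QuotientGroup.mk_surjective w
  rfl

theorem range_zeroMap (i : Bool) : Set.range (zeroMap D i) = zeroOrbit D i := by
  ext m
  constructor
  · rintro ⟨w, rfl⟩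
    obtain ⟨g, rfl⟩ := QuotientGroup.mk_surjective w
    exact ⟨(0, g), rfl, rfl⟩
  · rintro ⟨⟨x, g⟩, hx, rfl⟩
    obtain rfl : x = 0 := hx
    exact ⟨g, rfl⟩

theorem zeroMap_injective (i : Bool) : Function.Injective (zeroMap D i) := by
  intro v w h
  obtain ⟨g, rfl⟩ := QuotientGroup.mk_surjective v
  obtain ⟨g', rfl⟩ := QuotientGroup.mk_surjective w
  obtain ⟨z, hz⟩ := mk_eq_mk.1 h
  obtain rfl : g' = g * (α i z)⁻¹ := congrArg Prod.snd hz
  have hm : (α i z)⁻¹ ∈ (α i).range := inv_mem ⟨z, rfl⟩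
  exact (QuotientGroup.mk_mul_of_mem g hm).symm

theorem continuous_zeroMap (i : Bool) : Continuous (zeroMap D i) :=
  Continuous.quotient_lift ((continuous_mk i).comp (continuous_const.prodMk continuous_id)) _

/-- A continuous injection from a compact space to a Hausdorff space is a closed embedding. -/
theorem isEmbedding_zeroMap (i : Bool) : Topology.IsEmbedding (zeroMap D i) :=
  ((continuous_zeroMap i).isClosedEmbedding (zeroMap_injective i)).isEmbedding

/-- The charts of the coset space and of the tube at `g₀` come from the same slice, so the map reads
v ↦ (0, v) in them. -/
theorem isSmoothEmbedding_zeroMap (i : Bool) : letI := (D i).cosetAtlas.chartedSpace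
    Manifold.IsSmoothEmbedding (𝓡 7) (𝓡 11) ∞ (zeroMap D i) := by
  let := (D i).cosetAtlas.chartedSpace
  refine ⟨Manifold.IsImmersionOfComplement.isImmersion (F := C2) fun w => ?_,
    isEmbedding_zeroMap i⟩
  obtain ⟨g₀, rfl⟩ := QuotientGroup.mk_surjective w
  refine .mk_of_charts ((ContinuousLinearEquiv.prodComm ℝ _ _).trans lin)
    ((D i).cosetAtlas.chart () g₀) ((gluedAtlas D).chart i (0, g₀))
    ((D i).cosetAtlas.mem_chart_source () g₀) ((gluedAtlas D).mem_chart_source i (0, g₀))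
    ((D i).cosetAtlas.chart_mem_maximalAtlas () g₀)
    ((gluedAtlas D).chart_mem_maximalAtlas i (0, g₀))
    ?_ ?_
  · rintro _ ⟨g, hg, rfl⟩
    exact ⟨(0, g), hg, rfl⟩
  · intro v hv
    have hc : v ∈ ((D i).cosetAtlas.chart () g₀).target := by simpa using hv
    have hv' : v ∈ (D i).slice.target := hc
    have h1 : (0, g₀ * (D i).slice.sec v) ∈ ((gluedAtlas D).box i (0, g₀)).source := by
      change g₀⁻¹ * (g₀ * (D i).slice.sec v) ∈ (D i).slice.source
      rw [inv_mul_cancel_left]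
      simpa using (D i).slice.sec_mul_mem hv' 1
    change (gluedAtlas D).chart i (0, g₀) (mk D i (0, g₀ * (D i).slice.sec v)) = lin (0, v)
    rw [(gluedAtlas D).chart_map h1]
    change lin (_ • (0 : C2), (D i).slice.coord (g₀⁻¹ * (g₀ * (D i).slice.sec v))) = _
    have h2 := (D i).slice.coord_sec_mul hv' 1
    rw [map_one, mul_one] at h2
    rw [inv_mul_cancel_left, h2, smul_zero]

theorem isSubmersion_coset {β : Circle →* SU3} (D : TubeData β) :
    letI := D.cosetAtlas.chartedSpace
    Manifold.IsSubmersion (𝓡 8) (𝓡 7) ∞ (QuotientGroup.mk : SU3 → SU3 ⧸ β.range) := by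
  refine D.cosetAtlas.isSubmersion (ContinuousLinearEquiv.ofFinrankEq ?_) ()
  rw [Module.finrank_prod, finrank_euclideanSpace_fin, finrank_euclideanSpace_fin,
    Module.finrank_self]

/-! #### The tubes -/

variable (D) in
/-- The inclusion of the tube `i`. -/
def tube (i : Bool) : AssocBundle (α i) → Glued D :=
  Quotient.lift (mk D i) fun _ _ ⟨z, hz⟩ => mk_eq_mk.2 ⟨z, hz⟩

theorem tube_mk (i : Bool) (a : C2 × SU3) : tube D i (AssocBundle.mk (α i) a) = mk D i a := rfl

theorem exists_assoc_mk_eq {β : Circle →* SU3} (b : AssocBundle β) :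
    ∃ a, AssocBundle.mk β a = b := Quotient.exists_rep b

theorem tube_injective (i : Bool) : Function.Injective (tube D i) := by
  intro b b' h
  obtain ⟨a, rfl⟩ := exists_assoc_mk_eq b
  obtain ⟨a', rfl⟩ := exists_assoc_mk_eq b'
  exact Quotient.sound (mk_eq_mk.1 h)

theorem tube_smul (i : Bool) (g : SU3) (b : AssocBundle (α i)) :
    tube D i (g • b) = g • tube D i b := by
  obtain ⟨a, rfl⟩ := exists_assoc_mk_eq b
  rfl

theorem isTube (i : Bool) : AssocBundle.IsTube (tube D i) :=
  ⟨tube_injective i, tube_smul i, isSubmersion_mk i⟩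

/-- This allows the sphere bundles, which carry the subspace topology of their tubes, to be compared
inside the glued space. -/
theorem isEmbedding_tube (i : Bool) : Topology.IsEmbedding (tube D i) := by
  have hc : Continuous (tube D i) := Continuous.quotient_lift (continuous_mk i) _
  refine (Topology.IsOpenEmbedding.of_continuous_injective_isOpenMap hc (tube_injective i)
    fun U hU => ?_).isEmbedding
  have : tube D i '' U = mk D i '' (AssocBundle.mk (α i) ⁻¹' U) := by
    ext m
    constructor
    · rintro ⟨b, hb, rfl⟩
      obtain ⟨a, rfl⟩ := exists_assoc_mk_eq b
      exact ⟨a, hb, rfl⟩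
    · rintro ⟨a, ha, rfl⟩
      exact ⟨_, ha, rfl⟩
  rw [this]
  exact isOpenMap_mk i _ (hU.preimage continuous_quotient_mk')

theorem tube_image (i : Bool) (s : Set (C2 × SU3)) :
    tube D i '' (AssocBundle.mk (α i) '' s) = mk D i '' s := by
  rw [Set.image_image]
  rfl

/-- The unit sphere bundles of the two tubes have the same image. -/
theorem mk_image_sphere_subset (i : Bool) :
    mk D i '' {a | ‖a.1‖ = 1} ⊆ mk D (!i) '' {a | ‖a.1‖ = 1} := by
  rintro _ ⟨a, ha, rfl⟩
  have ha' : ‖a.1‖ = 1 := ha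
  have h0 : a.1 ≠ 0 := norm_ne_zero_iff.1 (by rw [ha']; exact one_ne_zero)
  refine ⟨glue D i a, ?_, mk_glue i h0⟩
  change ‖C2.invert a.1‖ = 1
  rw [C2.norm_invert, ha', inv_one]

theorem tube_image_sphere :
    tube D true '' AssocBundle.sphere (α true) = tube D false '' AssocBundle.sphere (α false) := by
  rw [AssocBundle.sphere, AssocBundle.sphere, tube_image, tube_image]
  exact (mk_image_sphere_subset true).antisymm (mk_image_sphere_subset false)

variable (D) in
/-- The identification of the unit sphere bundles of the two tubes. -/
noncomputable def sphereHomeomorph :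
    AssocBundle.sphere (α true) ≃ₜ AssocBundle.sphere (α false) :=
  ((isEmbedding_tube (D := D) true).homeomorphImage _).trans
    ((Homeomorph.setCongr tube_image_sphere).trans
      ((isEmbedding_tube (D := D) false).homeomorphImage _).symm)

theorem tube_sphereHomeomorph (b : AssocBundle.sphere (α true)) :
    tube D false (sphereHomeomorph D b) = tube D true b := by
  have := ((isEmbedding_tube (D := D) false).homeomorphImage
    (AssocBundle.sphere (α false))).apply_symm_apply
      (Homeomorph.setCongr tube_image_sphere
        ((isEmbedding_tube (D := D) true).homeomorphImage _ b))
  exact congrArg Subtype.val this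

variable (D) in
/-- The isomorphism of sphere bundles along which the disc bundles are glued. -/
noncomputable def sphereIso : AssocBundle.SphereIso (α true) (α false) where
  toHomeomorph := sphereHomeomorph D
  map_smul g b b' h := by
    refine tube_injective (D := D) false ?_
    rw [tube_smul, tube_sphereHomeomorph, tube_sphereHomeomorph, h, tube_smul]
  covers_id b x g h := by
    have hx : ‖x‖ = 1 := by
      obtain ⟨a, ha, hab⟩ := b.2
      obtain ⟨z, hz⟩ := Quotient.exact (hab.trans h)
      have h1 : x = (z : ℂ) • a.1 := congrArg Prod.fst hz
      rw [h1, C2.norm_circle_smul]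
      exact ha
    have h0 : x ≠ 0 := norm_ne_zero_iff.1 (by rw [hx]; exact one_ne_zero)
    -- Inversion fixes the unit vector `x`, so the gluing changes only the group component.
    refine ⟨(glue D true (x, g)).2, tube_injective (D := D) false ?_⟩
    rw [tube_sphereHomeomorph, h, tube_mk, ← mk_glue (a := (x, g)) true h0]
    refine congrArg (mk D false) (Prod.ext ?_ rfl)
    exact C2.invert_of_norm_eq_one hx

/-- A point common to both disc bundles satisfies |x| ≤ 1 and |x|⁻¹ ≤ 1, hence lies on the unit
sphere bundle. -/
theorem isGluing : AssocBundle.IsGluing (α true) (α false) (zeroOrbit D true)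
    (zeroOrbit D false) := by
  refine ⟨tube D true, tube D false, sphereIso D, isTube true, isTube false,
    tube_image true _, tube_image false _, ?_, ?_, fun b => (tube_sphereHomeomorph b).symm⟩
  · rw [AssocBundle.disc, AssocBundle.disc, tube_image, tube_image, ← mk_disc_union (D := D)]
    ext m
    simp only [Set.mem_union, Set.mem_iUnion, Bool.exists_bool]
    exact or_comm
  · rw [AssocBundle.disc, AssocBundle.disc, AssocBundle.sphere, tube_image, tube_image, tube_image]
    refine Set.Subset.antisymm ?_ fun m hm => ⟨?_, ?_⟩
    · rintro _ ⟨⟨a, ha, rfl⟩, b, hb, hab⟩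
      have ha' : ‖a.1‖ ≤ 1 := ha
      obtain ⟨h0, z, rfl⟩ := mk_eq_mk_not (i := true).1 hab.symm
      have hb' : ‖(z : ℂ) • C2.invert a.1‖ ≤ 1 := hb
      rw [C2.norm_circle_smul, C2.norm_invert] at hb'
      exact ⟨a, le_antisymm ha' ((inv_le_one₀ (norm_pos_iff.2 h0)).1 hb'), rfl⟩
    · obtain ⟨a, ha, rfl⟩ := hm
      exact ⟨a, le_of_eq ha, rfl⟩
    · obtain ⟨a, ha, rfl⟩ := mk_image_sphere_subset true hm
      exact ⟨a, le_of_eq ha, rfl⟩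

end Glued

end TubeData

/-! ### Specialization to Aloff–Wallach spaces -/

theorem TubeData.Glued.isAloffWallachOrbit_zeroOrbit {a b : Bool → ℤ}
    (D : ∀ i, TubeData (torusHom (a i) (b i))) (i : Bool) :
    IsAloffWallachOrbit (a i) (b i) (zeroOrbit (α := fun i => torusHom (a i) (b i)) D i) := by
  refine ⟨(D i).cosetAtlas.chartedSpace, (D i).cosetAtlas.isManifold, isSubmersion_coset (D i),
    zeroMap (α := fun i => torusHom (a i) (b i)) D i, ?_, ?_, ?_⟩
  · exact isSmoothEmbedding_zeroMap (α := fun i => torusHom (a i) (b i)) i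
  · exact zeroMap_smul (α := fun i => torusHom (a i) (b i)) i
  · exact range_zeroMap (α := fun i => torusHom (a i) (b i)) i

/-- The gluing of the tubes with weights `a true, b true` and `a false, b false`. -/
theorem exists_gluing (a b : Bool → ℤ) (h : ∀ i, IsCoprime (a i) (b i)) :
    ∃ (M : Type) (_ : TopologicalSpace M) (_ : ChartedSpace (EuclideanSpace ℝ (Fin 11)) M)
      (_ : MulAction SU3 M),
      T2Space M ∧ SecondCountableTopology M ∧ CompactSpace M ∧ ConnectedSpace M ∧
      IsManifold (𝓡 11) ∞ M ∧ ContMDiffSMul (𝓡 8) (𝓡 11) ∞ SU3 M ∧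
      HasCohomogeneity (𝓡 8) (𝓡 11) SU3 M 3 ∧
      ∃ O₁ O₂ : Set M, O₁ ≠ O₂ ∧
        {O : Set M | IsSingularOrbit (𝓡 8) (𝓡 11) SU3 O} = {O₁, O₂} ∧
        (∀ m : M, MulAction.orbit SU3 m = O₁ ∨ MulAction.orbit SU3 m = O₂ ∨
          IsPrincipalOrbit SU3 (MulAction.orbit SU3 m)) ∧
        IsAloffWallachOrbit (a true) (b true) O₁ ∧ IsAloffWallachOrbit (a false) (b false) O₂ ∧
        AssocBundle.IsGluing (torusHom (a true) (b true))
          (torusHom (a false) (b false)) O₁ O₂ := by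
  let α (i : Bool) : Circle →* SU3 := torusHom (a i) (b i)
  obtain ⟨D⟩ : Nonempty (∀ i, TubeData (α i)) := ⟨fun i => (exists_tubeData (h i)).some⟩
  refine ⟨TubeData.Glued D, inferInstance, inferInstance, inferInstance, inferInstance,
    ChartedSpace.secondCountable_of_sigmaCompact (EuclideanSpace ℝ (Fin 11)) _, inferInstance,
    inferInstance, inferInstance, inferInstance, TubeData.Glued.hasCohomogeneity,
    TubeData.Glued.zeroOrbit D true, TubeData.Glued.zeroOrbit D false,
    TubeData.Glued.zeroOrbit_ne, Set.ext TubeData.Glued.isSingularOrbit_iff, fun m => ?_,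
    TubeData.Glued.isAloffWallachOrbit_zeroOrbit D true,
    TubeData.Glued.isAloffWallachOrbit_zeroOrbit D false,
    TubeData.Glued.isGluing (α := α) (D := D)⟩
  obtain ⟨i, c, rfl⟩ := TubeData.Glued.exists_mk_eq m
  by_cases hc : c.1 = 0
  · rw [TubeData.Glued.orbit_mk_of_eq_zero hc]
    cases i
    · exact Or.inr (Or.inl rfl)
    · exact Or.inl rfl
  · exact Or.inr (Or.inr (TubeData.Glued.isPrincipalOrbit_mk hc))

theorem mainTheorem3 (p₁ p₂ q₁ q₂ : ℤ) (hp : IsCoprime p₁ p₂) (hq : IsCoprime q₁ q₂) :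
    ∃ (M : Type) (_ : TopologicalSpace M) (_ : ChartedSpace (EuclideanSpace ℝ (Fin 11)) M)
      (_ : MulAction SU3 M),
      T2Space M ∧ SecondCountableTopology M ∧ CompactSpace M ∧ ConnectedSpace M ∧
      IsManifold (𝓡 11) ∞ M ∧ ContMDiffSMul (𝓡 8) (𝓡 11) ∞ SU3 M ∧
      HasCohomogeneity (𝓡 8) (𝓡 11) SU3 M 3 ∧
      ∃ O₁ O₂ : Set M, O₁ ≠ O₂ ∧
        {O : Set M | IsSingularOrbit (𝓡 8) (𝓡 11) SU3 O} = {O₁, O₂} ∧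
        (∀ m : M, MulAction.orbit SU3 m = O₁ ∨ MulAction.orbit SU3 m = O₂ ∨
          IsPrincipalOrbit SU3 (MulAction.orbit SU3 m)) ∧
        IsAloffWallachOrbit p₁ p₂ O₁ ∧ IsAloffWallachOrbit q₁ q₂ O₂ ∧
        AssocBundle.IsGluing (torusHom p₁ p₂) (torusHom q₁ q₂) O₁ O₂ := by
  -- The tube indexed by `true` has weights `p₁, p₂`; `Bool.rec` takes the `false` case first.
  exact exists_gluing (fun i => cond i p₁ q₁) (fun i => cond i p₂ q₂) (Bool.rec hq hp)
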